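/- Let $\mathbf k$ be a field, $n\ge 0$, $S_n=\mathbf k[z_1,\dots,z_n]$ with its natural $\mathbb Z^n$-grading ($z_i$ has degree the $i$-th basis vector), and let $\mathbf T=\mathbf G_m^n$ act on $\mathbb A^n=\operatorname{Spec} S_n$ by rescaling the coordinates. Let $\operatorname{coh}[\mathbb A^n/\mathbf T]$ be the abelian category of $\mathbf T$-equivariant coherent sheaves on $\mathbb A^n$, identified as usual with the category of finitely generated $\mathbb Z^n$-graded $S_n$-modules and degree-preserving $S_n$-linear maps. For $I\subseteq\{1,\dots,n\}$ and $p\in\mathbb Z^n$ let $\mathcal O_{I,p}$ be the equivariant sheaf given by the graded module $S_n/\langle z_i : i\in I\rangle(-p)$, whose generator $1$ has degree $p$. For $a\in\mathbb Z^n$ put $I_a=\{i : a_i\ne 0\}$, $p_a(i)=a_i$ if $a_i\le 0$, $p_a(i)=a_i-1$ if $a_i>0$, and $$E_a=\mathcal O_{I_a,p_a}\Big[\sum_{i=1}^n p_a(i)\Big]\in \mathbf D^b(\operatorname{coh}[\mathbb A^n/\mathbf T]).$$ The map $a\mapsto (I_a,p_a)$ is a bijection from $\mathbb Z^n$ onto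 the set of pairs $(I,p)$ with $p(i)=0$ for all $i\notin I$, and: 1. The objects $E_a$, $a\in\mathbb Z^n$, ordered lexicographically, form a strong full exceptional collection in $\mathbf D^b(\operatorname{coh}[\mathbb A^n/\mathbf T])$. That is: $\operatorname{Hom}(E_a,E_a)\cong\mathbf k$; $\operatorname{Hom}(E_b,E_a[m])=0$ for all $m\in\mathbb Z$ if $a<b$; $\operatorname{Hom}(E_a,E_b[m])=0$ for all $a,b$ and all $m\neq 0$; and the only strictly full triangulated subcategory that contains all $E_a$ is the whole category. 2. $\operatorname{Hom}(E_a,E_b)$ is one-dimensional over $\mathbf k$ if for every $i$ either $b_i-a_i\in\{0,1\}$ or $(b_i,a_i)=(1,-1)$, and it is zero otherwise. 3. The composition $\operatorname{Hom}(E_a,E_b)\otimes\operatorname{Hom}(E_b,E_c)\to\operatorname{Hom}(E_a,E_c)$ is nonzero if and only if all three spaces are nonzero. One can choose generators $\rho_{a,b}$ of all the nonzero spaces $\operatorname{Hom}(E_a,E_b)$ simultaneously such that $\rho_{b,c}\circ\rho_{a,b}=\rho_{a,c}$ whenever $\operatorname{Hom}(E_a,E_b)$, $\operatorname{Hom}(E_b,E_c)$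 and $\operatorname{Hom}(E_a,E_c)$ are all nonzero. -/

import Mathlib

open CategoryTheory CategoryTheory.Limits

universe u

noncomputable section

/-! ### Graded pieces and projections -/

/-- Recognising an internal direct sum decomposition from a family of projections. -/
theorem isInternal_of_proj {ι M : Type*} [DecidableEq ι] [AddCommGroup M]
    (P : ι → AddSubgroup M) (π : ι → M →+ M)
    (hmem : ∀ i x, π i x ∈ P i) (hself : ∀ i, ∀ x ∈ P i, π i x = x)
    (hne : ∀ i j, i ≠ j → ∀ x ∈ P i, π j x = 0)
    (hsum : ∀ x, ∃ s : Finset ι, x = ∑ i ∈ s, π i x) : DirectSum.IsInternal P := by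
  classical
  constructor
  · rw [injective_iff_map_eq_zero]
    intro x hx
    refine DFinsupp.ext fun j => ?_
    have key : ∀ y : DirectSum ι (fun i => P i),
        π j (DirectSum.coeAddMonoidHom P y) = (y j : M) := by
      intro y
      induction y using DirectSum.induction_on with
      | zero => simp
      | of i z =>
        rw [DirectSum.coeAddMonoidHom_of]
        by_cases h : i = j
        · subst h
          rw [hself _ _ z.2, DirectSum.of_eq_same]
        · rw [hne i j h _ z.2, DirectSum.of_eq_of_ne _ _ _ (Ne.symm h)]
          rfl
      | add a b ha hb => rw [map_add, map_add, ha, hb]; rfl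
    have := key x
    rw [hx, map_zero] at this
    exact Subtype.ext this.symm
  · intro x
    obtain ⟨s, hs⟩ := hsum x
    refine ⟨∑ i ∈ s, DirectSum.of (fun i => P i) i ⟨π i x, hmem i x⟩, ?_⟩
    rw [map_sum]
    simp only [DirectSum.coeAddMonoidHom_of]
    exact hs.symm

/-- The polynomial ring `S_n = k[z_1, …, z_n]`, the coordinate ring of affine space. -/
abbrev PolyRing (k : Type u) [Field k] (n : ℕ) : Type u := MvPolynomial (Fin n) k

/-- The natural `ℤ^n`-grading of `S_n`: the piece of degree `r` is spanned by the monomials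
`∏ z_i ^ d_i` with `d = r`; in other words `z_i` has degree the `i`-th basis vector. -/
abbrev polyPiece (k : Type u) [Field k] (n : ℕ) (r : Fin n → ℤ) : Submodule k (PolyRing k n) :=
  MvPolynomial.weightedHomogeneousSubmodule k (fun i : Fin n => (Pi.single i 1 : Fin n → ℤ)) r

/-- A `T`-equivariant coherent sheaf on `𝔸^n = Spec S_n`, for `T = 𝔾_m^n` acting by rescaling the
coordinates, given by its module of global sections with the weight grading of the torus: a finitely generated `S_n`-module `M` with a decomposition `M = ⨁_q M_q` over the
character lattice `ℤ^n` of `T` such that `(S_n)_r • M_q ⊆ M_{r + q}`. -/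
structure EqCoh (k : Type u) [Field k] (n : ℕ) : Type (u + 1) where
  /-- the underlying module of global sections -/
  carrier : Type u
  [addCommGroup : AddCommGroup carrier]
  [module : Module (PolyRing k n) carrier]
  [finite : Module.Finite (PolyRing k n) carrier]
  /-- the graded pieces (the weight spaces of the torus) -/
  piece : (Fin n → ℤ) → AddSubgroup carrier
  isInternal : DirectSum.IsInternal piece
  smul_mem : ∀ (r q : Fin n → ℤ) (f : PolyRing k n) (x : carrier),
    f ∈ polyPiece k n r → x ∈ piece q → f • x ∈ piece (r + q)

namespace EqCoh

variable {k : Type u} [Field k] {n : ℕ}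

attribute [instance] EqCoh.addCommGroup EqCoh.module EqCoh.finite

instance (X : EqCoh k n) : DirectSum.Decomposition X.piece := X.isInternal.chooseDecomposition

/-- The projection onto the graded piece of degree `q`. -/
def proj (X : EqCoh k n) (q : Fin n → ℤ) : X.carrier →+ X.carrier where
  toFun x := (DirectSum.decompose X.piece x q : X.carrier)
  map_zero' := by rw [DirectSum.decompose_zero]; rfl
  map_add' x y := by rw [DirectSum.decompose_add]; rfl

theorem proj_mem (X : EqCoh k n) (q : Fin n → ℤ) (x : X.carrier) : X.proj q x ∈ X.piece q :=
  (DirectSum.decompose X.piece x q).2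

theorem proj_self (X : EqCoh k n) (q : Fin n → ℤ) (x : X.carrier) (hx : x ∈ X.piece q) :
    X.proj q x = x :=
  DirectSum.decompose_of_mem_same X.piece hx

theorem proj_ne (X : EqCoh k n) (q r : Fin n → ℤ) (h : q ≠ r) (x : X.carrier)
    (hx : x ∈ X.piece q) : X.proj r x = 0 :=
  DirectSum.decompose_of_mem_ne X.piece hx h

theorem proj_sum (X : EqCoh k n) (x : X.carrier) :
    ∃ s : Finset (Fin n → ℤ), x = ∑ q ∈ s, X.proj q x := by
  classical
  exact ⟨_, (DirectSum.sum_support_decompose X.piece x).symm⟩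

/-- Morphisms: `S_n`-linear maps that preserve degrees, i.e. `T`-equivariant maps. -/
@[ext]
structure Hom (X Y : EqCoh k n) : Type u where
  /-- the underlying linear map -/
  toLin : X.carrier →ₗ[PolyRing k n] Y.carrier
  map_mem : ∀ (q : Fin n → ℤ) (x : X.carrier), x ∈ X.piece q → toLin x ∈ Y.piece q

instance : Category.{u} (EqCoh k n) where
  Hom X Y := Hom X Y
  id X := ⟨LinearMap.id, fun _ _ h => h⟩
  comp f g := ⟨g.toLin.comp f.toLin, fun q x h => g.map_mem q _ (f.map_mem q x h)⟩

@[ext]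
theorem hom_ext {X Y : EqCoh k n} {f g : X ⟶ Y} (h : ∀ x, f.toLin x = g.toLin x) : f = g :=
  Hom.ext (LinearMap.ext h)

@[simp] theorem id_apply (X : EqCoh k n) (x : X.carrier) : (𝟙 X : X ⟶ X).toLin x = x := rfl

@[simp] theorem comp_apply {X Y Z : EqCoh k n} (f : X ⟶ Y) (g : Y ⟶ Z) (x : X.carrier) :
    (f ≫ g).toLin x = g.toLin (f.toLin x) := rfl

theorem toLin_proj {X Y : EqCoh k n} (f : X ⟶ Y) (q : Fin n → ℤ) (x : X.carrier) :
    f.toLin (X.proj q x) = Y.proj q (f.toLin x) := by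
  induction x using DirectSum.Decomposition.inductionOn X.piece with
  | zero => simp
  | @homogeneous i m =>
    by_cases h : i = q
    · subst h
      rw [proj_self _ _ _ m.2, proj_self _ _ _ (f.map_mem _ _ m.2)]
    · rw [proj_ne _ _ _ h _ m.2, proj_ne _ _ _ h _ (f.map_mem _ _ m.2), map_zero]
  | add a b ha hb => rw [map_add, map_add, map_add, map_add, ha, hb]

/-! ### The `k`-linear structure -/

instance (X Y : EqCoh k n) : Zero (X ⟶ Y) :=
  ⟨⟨0, fun q _ _ => (Y.piece q).zero_mem⟩⟩

instance (X Y : EqCoh k n) : Add (X ⟶ Y) :=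
  ⟨fun f g => ⟨f.toLin + g.toLin, fun q x h =>
    (Y.piece q).add_mem (f.map_mem q x h) (g.map_mem q x h)⟩⟩

instance (X Y : EqCoh k n) : Neg (X ⟶ Y) :=
  ⟨fun f => ⟨-f.toLin, fun q x h => (Y.piece q).neg_mem (f.map_mem q x h)⟩⟩

theorem C_smul_mem (X : EqCoh k n) (c : k) (q : Fin n → ℤ) (x : X.carrier) (hx : x ∈ X.piece q) :
    (MvPolynomial.C c : PolyRing k n) • x ∈ X.piece q := by
  have := X.smul_mem 0 q (MvPolynomial.C c) x (MvPolynomial.isWeightedHomogeneous_C _ c) hx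
  rwa [zero_add] at this

instance (X Y : EqCoh k n) : SMul k (X ⟶ Y) :=
  ⟨fun c f => ⟨(MvPolynomial.C c : PolyRing k n) • f.toLin, fun q x h =>
    Y.C_smul_mem c q _ (f.map_mem q x h)⟩⟩

@[simp] theorem zero_apply {X Y : EqCoh k n} (x : X.carrier) : (0 : X ⟶ Y).toLin x = 0 := rfl

@[simp] theorem add_apply {X Y : EqCoh k n} (f g : X ⟶ Y) (x : X.carrier) :
    (f + g).toLin x = f.toLin x + g.toLin x := rfl

@[simp] theorem neg_apply {X Y : EqCoh k n} (f : X ⟶ Y) (x : X.carrier) :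
    (-f).toLin x = -f.toLin x := rfl

@[simp] theorem smul_apply {X Y : EqCoh k n} (c : k) (f : X ⟶ Y) (x : X.carrier) :
    (c • f).toLin x = (MvPolynomial.C c : PolyRing k n) • f.toLin x := rfl

instance (X Y : EqCoh k n) : AddCommGroup (X ⟶ Y) where
  add_assoc f g h := by ext x; simp [add_assoc]
  zero_add f := by ext x; simp
  add_zero f := by ext x; simp
  nsmul := nsmulRec
  zsmul := zsmulRec
  neg_add_cancel f := by ext x; simp
  add_comm f g := by ext x; simp [add_comm]

instance : Preadditive (EqCoh k n) where
  add_comp _ _ _ f f' g := by ext x; simp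
  comp_add _ _ _ f g g' := by ext x; simp

instance (X Y : EqCoh k n) : Module k (X ⟶ Y) where
  one_smul f := by ext x; simp
  mul_smul a b f := by ext x; simp [mul_smul]
  smul_zero a := by ext x; simp
  smul_add a f g := by ext x; simp
  add_smul a b f := by ext x; simp [add_smul]
  zero_smul f := by ext x; simp

instance : Linear k (EqCoh k n) where
  smul_comp _ _ _ c f g := by ext x; simp
  comp_smul _ _ _ f c g := by ext x; simp

/-! ### Sub- and quotient objects, finite direct sums -/

/-- A submodule is homogeneous if it contains the graded components of its elements. -/
def IsHomog (X : EqCoh k n) (H : Submodule (PolyRing k n) X.carrier) : Prop :=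
  ∀ x ∈ H, ∀ q, X.proj q x ∈ H

/-- A homogeneous submodule with the induced grading. -/
def sub (X : EqCoh k n) (H : Submodule (PolyRing k n) X.carrier) (hH : X.IsHomog H) :
    EqCoh k n where
  carrier := H
  piece q := (X.piece q).comap H.subtype.toAddMonoidHom
  isInternal := by
    refine isInternal_of_proj _
      (fun q => (⟨⟨fun x => ⟨X.proj q x.1, hH x.1 x.2 q⟩, Subtype.ext (map_zero _)⟩,
        fun x y => Subtype.ext (map_add _ _ _)⟩ : H →+ H)) ?_ ?_ ?_ ?_
    · exact fun q x => X.proj_mem q x.1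
    · exact fun q x hx => Subtype.ext (X.proj_self q x.1 hx)
    · exact fun q r h x hx => Subtype.ext (X.proj_ne q r h x.1 hx)
    · intro x
      obtain ⟨s, hs⟩ := X.proj_sum x.1
      refine ⟨s, Subtype.ext (hs.trans ?_)⟩
      exact (map_sum H.subtype (fun q => (⟨X.proj q x.1, hH x.1 x.2 q⟩ : H)) s).symm
  smul_mem r q f x hf hx := X.smul_mem r q f x.1 hf hx

/-- The quotient by a homogeneous submodule with the induced grading. -/
def quot (X : EqCoh k n) (H : Submodule (PolyRing k n) X.carrier) (hH : X.IsHomog H) :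
    EqCoh k n where
  carrier := X.carrier ⧸ H
  piece q := (X.piece q).map H.mkQ.toAddMonoidHom
  isInternal := by
    have hmk : ∀ (q : Fin n → ℤ) (x : X.carrier),
        (QuotientAddGroup.map H.toAddSubgroup H.toAddSubgroup (X.proj q)
          (fun x hx => hH x hx q)) (H.mkQ x) = H.mkQ (X.proj q x) := fun q x => rfl
    refine isInternal_of_proj _
      (fun q => QuotientAddGroup.map H.toAddSubgroup H.toAddSubgroup (X.proj q)
        (fun x hx => hH x hx q)) ?_ ?_ ?_ ?_
    · intro q x
      obtain ⟨x, rfl⟩ := H.mkQ_surjective x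
      exact ⟨X.proj q x, X.proj_mem q x, rfl⟩
    · rintro q _ ⟨x, hx, rfl⟩
      exact congrArg H.mkQ (X.proj_self q x hx)
    · rintro q r h _ ⟨x, hx, rfl⟩
      exact (congrArg H.mkQ (X.proj_ne q r h x hx)).trans (map_zero _)
    · intro x
      obtain ⟨x, rfl⟩ := H.mkQ_surjective x
      obtain ⟨s, hs⟩ := X.proj_sum x
      refine ⟨s, ?_⟩
      conv_lhs => rw [hs]
      rw [map_sum]
      rfl
  smul_mem := by
    rintro r q f _ hf ⟨x, hx, rfl⟩
    exact ⟨f • x, X.smul_mem r q f x hf hx, map_smul H.mkQ f x⟩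

/-- The inclusion of a homogeneous submodule. -/
def subι (X : EqCoh k n) (H : Submodule (PolyRing k n) X.carrier) (hH : X.IsHomog H) :
    X.sub H hH ⟶ X :=
  ⟨H.subtype, fun _ _ h => h⟩

/-- The projection to the quotient by a homogeneous submodule. -/
def quotπ (X : EqCoh k n) (H : Submodule (PolyRing k n) X.carrier) (hH : X.IsHomog H) :
    X ⟶ X.quot H hH :=
  ⟨H.mkQ, fun _ x h => ⟨x, h, rfl⟩⟩

/-- The direct sum of two objects. -/
def prod (X Y : EqCoh k n) : EqCoh k n where
  carrier := X.carrier × Y.carrier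
  piece q := (X.piece q).prod (Y.piece q)
  isInternal := by
    classical
    refine isInternal_of_proj _ (fun q => (X.proj q).prodMap (Y.proj q)) ?_ ?_ ?_ ?_
    · exact fun q x => ⟨X.proj_mem q x.1, Y.proj_mem q x.2⟩
    · exact fun q x hx => Prod.ext (X.proj_self q _ hx.1) (Y.proj_self q _ hx.2)
    · exact fun q r h x hx => Prod.ext (X.proj_ne q r h _ hx.1) (Y.proj_ne q r h _ hx.2)
    · rintro ⟨x, y⟩
      obtain ⟨s, hs⟩ := X.proj_sum x
      obtain ⟨t, ht⟩ := Y.proj_sum y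
      have aux : ∀ (Z : EqCoh k n) (z : Z.carrier) (s t : Finset (Fin n → ℤ)),
          z = ∑ q ∈ s, Z.proj q z → s ⊆ t → z = ∑ q ∈ t, Z.proj q z := by
        intro Z z s t h hst
        conv_lhs => rw [h]
        refine Finset.sum_subset hst fun q _ hq => ?_
        conv_lhs => rw [h]
        rw [map_sum]
        refine Finset.sum_eq_zero fun r hr => Z.proj_ne r q ?_ _ (Z.proj_mem r z)
        rintro rfl
        exact hq hr
      refine ⟨s ∪ t, Prod.ext ?_ ?_⟩
      · rw [Prod.fst_sum]
        exact aux X x s _ hs Finset.subset_union_left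
      · rw [Prod.snd_sum]
        exact aux Y y t _ ht Finset.subset_union_right
  smul_mem r q f x hf hx :=
    ⟨X.smul_mem r q f x.1 hf hx.1, Y.smul_mem r q f x.2 hf hx.2⟩

/-- The zero object. -/
def zeroObj (k : Type u) [Field k] (n : ℕ) : EqCoh k n where
  carrier := PUnit
  piece _ := ⊥
  isInternal := isInternal_of_proj _ (fun _ => 0) (fun _ _ => Subsingleton.elim _ _)
    (fun _ _ _ => Subsingleton.elim _ _) (fun _ _ _ _ _ => rfl)
    (fun _ => ⟨∅, Subsingleton.elim _ _⟩)
  smul_mem _ _ _ _ _ _ := Subsingleton.elim _ _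

/-! ### The category is abelian -/

theorem ker_isHomog {X Y : EqCoh k n} (f : X ⟶ Y) : X.IsHomog (LinearMap.ker f.toLin) := by
  intro x hx q
  rw [LinearMap.mem_ker] at hx ⊢
  rw [toLin_proj, hx, map_zero]

theorem range_isHomog {X Y : EqCoh k n} (f : X ⟶ Y) : Y.IsHomog (LinearMap.range f.toLin) := by
  rintro _ ⟨x, rfl⟩ q
  exact ⟨X.proj q x, toLin_proj f q x⟩

theorem mem_piece_of_injective {X Y : EqCoh k n} (f : X ⟶ Y) (hf : Function.Injective f.toLin)
    {q : Fin n → ℤ} {x : X.carrier} (hx : f.toLin x ∈ Y.piece q) : x ∈ X.piece q := by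
  have : X.proj q x = x := hf (by rw [toLin_proj, Y.proj_self q _ hx])
  rw [← this]
  exact X.proj_mem q x

theorem exists_of_surjective {X Y : EqCoh k n} (f : X ⟶ Y) (hf : Function.Surjective f.toLin)
    {q : Fin n → ℤ} {y : Y.carrier} (hy : y ∈ Y.piece q) :
    ∃ x ∈ X.piece q, f.toLin x = y := by
  obtain ⟨x, rfl⟩ := hf y
  exact ⟨X.proj q x, X.proj_mem q x, by rw [toLin_proj, Y.proj_self q _ hy]⟩

/-- Lift of `g` through an injective `f` whose range contains that of `g`. -/
def lift {X Y Z : EqCoh k n} (f : X ⟶ Y) (hf : Function.Injective f.toLin) (g : Z ⟶ Y)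
    (hg : ∀ z, g.toLin z ∈ LinearMap.range f.toLin) : Z ⟶ X where
  toLin := (LinearEquiv.ofInjective f.toLin hf).symm.toLinearMap.comp
    (g.toLin.codRestrict (LinearMap.range f.toLin) hg)
  map_mem q z hz := by
    refine mem_piece_of_injective f hf ?_
    have : f.toLin ((LinearEquiv.ofInjective f.toLin hf).symm ⟨g.toLin z, hg z⟩) = g.toLin z :=
      congrArg Subtype.val ((LinearEquiv.ofInjective f.toLin hf).apply_symm_apply ⟨_, hg z⟩)
    exact this ▸ g.map_mem q z hz

theorem lift_comp {X Y Z : EqCoh k n} (f : X ⟶ Y) (hf : Function.Injective f.toLin) (g : Z ⟶ Y)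
    (hg : ∀ z, g.toLin z ∈ LinearMap.range f.toLin) : lift f hf g hg ≫ f = g := by
  ext z
  exact congrArg Subtype.val ((LinearEquiv.ofInjective f.toLin hf).apply_symm_apply ⟨_, hg z⟩)

/-- Factorisation of `g` through a surjective `f` whose kernel is contained in that of `g`. -/
def desc {X Y Z : EqCoh k n} (f : X ⟶ Y) (hf : Function.Surjective f.toLin) (g : X ⟶ Z)
    (hg : LinearMap.ker f.toLin ≤ LinearMap.ker g.toLin) : Y ⟶ Z where
  toLin := ((LinearMap.ker f.toLin).liftQ g.toLin hg).comp
    (f.toLin.quotKerEquivOfSurjective hf).symm.toLinearMap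
  map_mem q y hy := by
    obtain ⟨x, hx, rfl⟩ := exists_of_surjective f hf hy
    have : (f.toLin.quotKerEquivOfSurjective hf).symm (f.toLin x) =
        (LinearMap.ker f.toLin).mkQ x := by
      rw [LinearEquiv.symm_apply_eq]; rfl
    rw [LinearMap.comp_apply, LinearEquiv.coe_coe, this]
    exact g.map_mem q x hx

theorem comp_desc {X Y Z : EqCoh k n} (f : X ⟶ Y) (hf : Function.Surjective f.toLin) (g : X ⟶ Z)
    (hg : LinearMap.ker f.toLin ≤ LinearMap.ker g.toLin) : f ≫ desc f hf g hg = g := by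
  ext x
  have : (f.toLin.quotKerEquivOfSurjective hf).symm (f.toLin x) =
      (LinearMap.ker f.toLin).mkQ x := by
    rw [LinearEquiv.symm_apply_eq]; rfl
  change ((LinearMap.ker f.toLin).liftQ g.toLin hg)
    ((f.toLin.quotKerEquivOfSurjective hf).symm (f.toLin x)) = _
  rw [this]
  rfl

/-- An injective morphism is a kernel of any morphism whose kernel is its range. -/
def isLimitOfInjective {X Y Z : EqCoh k n} (f : X ⟶ Y) (g : Y ⟶ Z) (w : f ≫ g = 0)
    (hf : Function.Injective f.toLin)
    (hfg : ∀ y, g.toLin y = 0 → y ∈ LinearMap.range f.toLin) :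
    IsLimit (KernelFork.ofι f w) :=
  KernelFork.IsLimit.ofι f w
    (fun h hw => lift f hf h (fun z => hfg _ (congrArg (fun t => t.toLin z) hw)))
    (fun _ _ => lift_comp _ _ _ _)
    (fun h hw m hm => by
      ext z
      apply hf
      rw [← comp_apply, ← comp_apply, lift_comp, hm])

/-- A surjective morphism is a cokernel of any morphism whose range is its kernel. -/
def isColimitOfSurjective {X Y Z : EqCoh k n} (f : X ⟶ Y) (g : Y ⟶ Z) (w : f ≫ g = 0)
    (hg : Function.Surjective g.toLin)
    (hfg : ∀ y, g.toLin y = 0 → y ∈ LinearMap.range f.toLin) :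
    IsColimit (CokernelCofork.ofπ g w) :=
  CokernelCofork.IsColimit.ofπ g w
    (fun h hw => desc g hg h (fun y hy => by
      obtain ⟨x, rfl⟩ := hfg y hy
      exact congrArg (fun t => t.toLin x) hw))
    (fun _ _ => comp_desc _ _ _ _)
    (fun h hw m hm => by
      ext z
      obtain ⟨y, rfl⟩ := hg z
      rw [← comp_apply, ← comp_apply, comp_desc, hm])

theorem subι_comp {X Y : EqCoh k n} (f : X ⟶ Y) :
    X.subι (LinearMap.ker f.toLin) (ker_isHomog f) ≫ f = 0 := by
  ext x
  exact x.2

theorem comp_quotπ {X Y : EqCoh k n} (f : X ⟶ Y) :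
    f ≫ Y.quotπ (LinearMap.range f.toLin) (range_isHomog f) = 0 := by
  ext x
  exact (Submodule.Quotient.mk_eq_zero _).2 ⟨x, rfl⟩

instance : HasKernels (EqCoh k n) where
  has_limit f := ⟨⟨⟨_, isLimitOfInjective _ f (subι_comp f)
    Subtype.val_injective (fun y hy => ⟨⟨y, hy⟩, rfl⟩)⟩⟩⟩

instance : HasCokernels (EqCoh k n) where
  has_colimit f := ⟨⟨⟨_, isColimitOfSurjective f _ (comp_quotπ f)
    (Submodule.mkQ_surjective _) (fun _ hy => (Submodule.Quotient.mk_eq_zero _).1 hy)⟩⟩⟩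

theorem injective_of_mono {X Y : EqCoh k n} (f : X ⟶ Y) [Mono f] :
    Function.Injective f.toLin := by
  have h : X.subι (LinearMap.ker f.toLin) (ker_isHomog f) = 0 := by
    rw [← cancel_mono f, subι_comp, zero_comp]
  rw [← LinearMap.ker_eq_bot, eq_bot_iff]
  intro x hx
  exact congrArg (fun t => t.toLin ⟨x, hx⟩) h

theorem surjective_of_epi {X Y : EqCoh k n} (f : X ⟶ Y) [Epi f] :
    Function.Surjective f.toLin := by
  have h : Y.quotπ (LinearMap.range f.toLin) (range_isHomog f) = 0 := by
    rw [← cancel_epi f, comp_quotπ, comp_zero]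
  intro y
  exact (Submodule.Quotient.mk_eq_zero _).1 (congrArg (fun t => t.toLin y) h)

instance : HasZeroObject (EqCoh k n) where
  zero := ⟨zeroObj k n, by
    rw [IsZero.iff_id_eq_zero]
    ext x
    exact Subsingleton.elim (α := PUnit) _ _⟩

/-- The direct sum as a binary bicone. -/
def bicone (X Y : EqCoh k n) : BinaryBicone X Y where
  pt := X.prod Y
  fst := ⟨LinearMap.fst _ _ _, fun _ _ h => h.1⟩
  snd := ⟨LinearMap.snd _ _ _, fun _ _ h => h.2⟩
  inl := ⟨LinearMap.inl _ _ _, fun q _ h => ⟨h, (Y.piece q).zero_mem⟩⟩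
  inr := ⟨LinearMap.inr _ _ _, fun q _ h => ⟨(X.piece q).zero_mem, h⟩⟩
  inl_fst := rfl
  inl_snd := rfl
  inr_fst := rfl
  inr_snd := rfl

instance : HasBinaryBiproducts (EqCoh k n) where
  has_binary_biproduct X Y := hasBinaryBiproduct_of_total (bicone X Y) (by
    ext x
    exact Prod.ext (add_zero x.1) (zero_add x.2))

instance : Abelian (EqCoh k n) where
  normalMonoOfMono f _ := ⟨⟨_, _, comp_quotπ f, isLimitOfInjective f _ (comp_quotπ f)
    (injective_of_mono f) (fun _ hy => (Submodule.Quotient.mk_eq_zero _).1 hy)⟩⟩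
  normalEpiOfEpi f _ := ⟨⟨_, _, subι_comp f, isColimitOfSurjective _ f (subι_comp f)
    (surjective_of_epi f) (fun y hy => ⟨⟨y, hy⟩, rfl⟩)⟩⟩
  has_finite_products := hasFiniteProducts_of_has_binary_and_terminal

/-! ### Twisted structure sheaves of coordinate subspaces -/

/-- The line bundle `𝒪(-p)`: the module `S_n(-p)`, i.e. `S_n` with its generator `1` in degree `p`. -/
def lineBundle (k : Type u) [Field k] {n : ℕ} (p : Fin n → ℤ) : EqCoh k n where
  carrier := PolyRing k n
  piece q := (polyPiece k n (q - p)).toAddSubgroup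
  isInternal := by
    refine isInternal_of_proj _ (fun q => (MvPolynomial.weightedHomogeneousComponent
      (fun i : Fin n => (Pi.single i 1 : Fin n → ℤ)) (q - p)).toAddMonoidHom) ?_ ?_ ?_ ?_
    · exact fun q x => MvPolynomial.weightedHomogeneousComponent_mem _ x _
    · exact fun q x hx => MvPolynomial.IsWeightedHomogeneous.weightedHomogeneousComponent_same hx
    · intro q r h x hx
      exact MvPolynomial.IsWeightedHomogeneous.weightedHomogeneousComponent_ne _ hx
        (fun e : r - p = q - p => h (sub_left_injective e).symm)
    · intro x
      have hf := MvPolynomial.weightedHomogeneousComponent_finsupp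
        (w := fun i : Fin n => (Pi.single i 1 : Fin n → ℤ)) x
      have hs := MvPolynomial.sum_weightedHomogeneousComponent
        (fun i : Fin n => (Pi.single i 1 : Fin n → ℤ)) x
      rw [finsum_eq_sum _ hf] at hs
      refine ⟨hf.toFinset.map (Equiv.addRight p).toEmbedding, ?_⟩
      rw [Finset.sum_map]
      conv_lhs => rw [← hs]
      refine Finset.sum_congr rfl fun q _ => ?_
      simp
  smul_mem r q f x hf hx := by
    have := MvPolynomial.IsWeightedHomogeneous.mul hf hx
    rw [← add_sub_assoc] at this
    exact this

theorem ideal_isHomog (k : Type u) [Field k] {n : ℕ} (I : Finset (Fin n)) (p : Fin n → ℤ) :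
    (lineBundle k p).IsHomog
      (Ideal.span (MvPolynomial.X '' (I : Set (Fin n))) : Ideal (PolyRing k n)) := by
  classical
  intro (x : PolyRing k n) hx q
  have hpr : ∀ y : PolyRing k n, (lineBundle k p).proj q y =
      MvPolynomial.weightedHomogeneousComponent
        (fun i : Fin n => (Pi.single i 1 : Fin n → ℤ)) (q - p) y := by
    intro y
    refine DirectSum.Decomposition.inductionOn (lineBundle k p).piece
      (motive := fun y => (lineBundle k p).proj q y =
        MvPolynomial.weightedHomogeneousComponent
        (fun i : Fin n => (Pi.single i 1 : Fin n → ℤ)) (q - p) (y : PolyRing k n)) ?_ ?_ ?_ y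
    · rw [map_zero]
      exact (map_zero (MvPolynomial.weightedHomogeneousComponent (R := k) _ (q - p))).symm
    · intro i m
      by_cases h : i = q
      · subst h
        rw [proj_self _ _ _ m.2]
        exact (MvPolynomial.IsWeightedHomogeneous.weightedHomogeneousComponent_same m.2).symm
      · rw [proj_ne _ _ _ h _ m.2]
        exact (MvPolynomial.IsWeightedHomogeneous.weightedHomogeneousComponent_ne _ m.2
          (fun e : q - p = i - p => h (sub_left_injective e).symm)).symm
    · intro a b ha hb
      rw [map_add, ha, hb]
      exact (map_add (MvPolynomial.weightedHomogeneousComponent (R := k) _ (q - p)) _ _).symm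
  rw [hpr]
  change _ ∈ (Ideal.span (MvPolynomial.X '' (I : Set (Fin n))) : Ideal (PolyRing k n))
  change x ∈ (Ideal.span (MvPolynomial.X '' (I : Set (Fin n))) : Ideal (PolyRing k n)) at hx
  rw [MvPolynomial.mem_ideal_span_X_image] at hx ⊢
  intro m hm
  refine hx m ?_
  rw [MvPolynomial.mem_support_iff, MvPolynomial.coeff_weightedHomogeneousComponent] at hm
  rw [MvPolynomial.mem_support_iff]
  intro h0
  apply hm
  rw [h0, ite_self]

/-- The sheaf `𝒪_{I,p}` given by the graded module `k[z_1, …, z_n]/⟨z_i, i ∈ I⟩ (-p)`: a twist of the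
structure sheaf of the coordinate subspace `{z_i = 0 for i ∈ I}`. -/
def strSheaf (k : Type u) [Field k] {n : ℕ} (I : Finset (Fin n)) (p : Fin n → ℤ) : EqCoh k n :=
  (lineBundle k p).quot _ (ideal_isHomog k I p)

end EqCoh

/-! ### The bounded derived category -/

instance (k : Type u) [Field k] (n : ℕ) : HasDerivedCategory.{u + 1} (EqCoh k n) :=
  HasDerivedCategory.standard _

/-- The bounded derived category `D^b(coh [𝔸^n/T])`: the full triangulated subcategory of the
derived category on the objects with bounded cohomology. -/
abbrev DbCoh (k : Type u) [Field k] (n : ℕ) : Type (u + 1) :=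
  (DerivedCategory.TStructure.t (C := EqCoh k n)).bounded.FullSubcategory

/-- A sheaf, as a complex concentrated in degree `0`. -/
def DbCoh.ofSheaf {k : Type u} [Field k] {n : ℕ} (F : EqCoh k n) : DbCoh k n :=
  ⟨(DerivedCategory.singleFunctor (EqCoh k n) 0).obj F, ⟨0, inferInstance⟩, ⟨0, inferInstance⟩⟩

/-! ### Strong full exceptional collections -/

/-- `E` is a strong full exceptional collection in the `k`-linear triangulated category `D`, with
respect to the linear order of the index set `ι`. -/
structure IsStrongFullExceptionalCollection (k : Type*) [Field k] {D : Type*} [Category D]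
    [Preadditive D] [Linear k D] [HasZeroObject D] [HasShift D ℤ]
    [∀ m : ℤ, (shiftFunctor D m).Additive] [Pretriangulated D]
    {ι : Type*} [LinearOrder ι] (E : ι → D) : Prop where
  /-- each `E a` is exceptional: `Hom(E a, E a) = k · id` -/
  end_eq : ∀ a, Module.finrank k (E a ⟶ E a) = 1
  /-- each `E a` is exceptional: `Hom(E a, E a[m]) = 0` for `m ≠ 0` -/
  self_ext : ∀ (a : ι) (m : ℤ), m ≠ 0 → ∀ f : E a ⟶ (E a)⟦m⟧, f = 0
  /-- `Hom(E b, E a[m]) = 0` for all `m` if `a < b` -/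
  semiorthogonal : ∀ (a b : ι), a < b → ∀ (m : ℤ) (f : E b ⟶ (E a)⟦m⟧), f = 0
  /-- strong: `Hom(E a, E b[m]) = 0` for `m ≠ 0` -/
  strong : ∀ (a b : ι) (m : ℤ), m ≠ 0 → ∀ f : E a ⟶ (E b)⟦m⟧, f = 0
  /-- full: a strictly full triangulated subcategory that contains all `E a` is all of `D` -/
  full : ∀ P : ObjectProperty D, P.IsTriangulated → P.IsClosedUnderIsomorphisms →
    (∀ a, P (E a)) → ∀ X, P X

/-! ### The collection -/

/-- The set `I` attached to `a ∈ ℤ^n`: the support of `a`. -/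
def indexSet {n : ℕ} (a : Fin n → ℤ) : Finset (Fin n) := {i | a i ≠ 0}

/-- The twist `p` attached to `a ∈ ℤ^n`: `p i = a i` if `a i ≤ 0` and `p i = a i - 1` if `a i > 0`. -/
def indexTwist {n : ℕ} (a : Fin n → ℤ) : Fin n → ℤ := fun i => if a i ≤ 0 then a i else a i - 1

/-- The object `E_a = 𝒪_{I,p}[∑ p i]` of `D^b(coh [𝔸^n/T])`. -/
def excObj (k : Type u) [Field k] {n : ℕ} (a : Fin n → ℤ) : DbCoh k n :=
  (DbCoh.ofSheaf (EqCoh.strSheaf k (indexSet a) (indexTwist a)))⟦∑ i, indexTwist a i⟧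

/-- The combinatorial condition for a nonzero morphism from `E_a` to `E_b`. -/
def HomCond {n : ℕ} (a b : Fin n → ℤ) : Prop :=
  ∀ i, b i - a i ∈ ({0, 1} : Set ℤ) ∨ (b i, a i) = (1, -1)

end

noncomputable section

namespace EqCoh

variable {k : Type u} [Field k] {n : ℕ}

/-! ### Graded free modules -/

/-! The sheaf 𝒪_{I,p} has a Koszul resolution by graded free modules, with one generator of degree e
for each e in the box given by e_i = p_i off I and e_i ∈ {p_i, p_i + 1} on I. The shift in E_a is
exactly the one that puts the generator of degree e in cohomological degree -∑ e_i, whatever the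
box, and the signs of the differential can be chosen to depend on e alone. In coordinate i the box
of a is {0}, {a_i, a_i + 1} or {a_i - 1, a_i} according to whether a_i is zero, negative or
positive.

These complexes are K-projective, so Hom(E_a, E_b[m]) is the cohomology of a complex built from the
pieces of 𝒪_{I_b,p_b} in the degrees e of the box of a. If b_i = 0 < a_i for some i, multiplication
by z_i is bijective between the pieces involved and the complex is contractible in direction i
(`koszul_cocycle_of_le`). Otherwise e = p_b is the only degree of the box in which 𝒪_{I_b,p_b} is
nonzero. It contributes one copy of k, for m = 0, exactly if p_b lies in the box of a, which then
amounts to `HomCond a b` (`excKoszul_cocycle_eq_coboundary`, `exists_eq_smul_aug`,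
`aug_ne_coboundary`). Since `HomCond` never lowers a coordinate, semiorthogonality follows.

The generator of Hom(E_a, E_b) is realised by the chain map that is the identity on the common
generators of the two Koszul complexes and zero on the others. If all three conditions hold, the
boxes of a and c meet inside the box of b, so these maps compose strictly (`excKoszulMap_comp`),
without any choice of scalars.

For fullness, truncation reduces bounded complexes to sheaves. Every sheaf is an iterated extension
of sheaves 𝒪_{I,p} (`exists_injective_strSheaf`), and the sequences 0 → 𝒪_{I,p+ε_i} → 𝒪_{I,p} →
𝒪_{I∪i,p} → 0, with ε_i the i-th basis vector, move p_i to 0 for i ∉ I (`prop_strSheaf`). -/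

theorem eq_sum_proj_of_subset (X : EqCoh k n) (x : X.carrier) {s t : Finset (Fin n → ℤ)}
    (h : x = ∑ q ∈ s, X.proj q x) (hst : s ⊆ t) : x = ∑ q ∈ t, X.proj q x := by
  conv_lhs => rw [h]
  refine Finset.sum_subset hst fun q _ hq => ?_
  conv_lhs => rw [h]
  rw [map_sum]
  refine Finset.sum_eq_zero fun r hr => X.proj_ne r q ?_ _ (X.proj_mem r x)
  rintro rfl
  exact hq hr

/-- The product of a finite family of objects. -/
def pi {ι : Type} [Fintype ι] (X : ι → EqCoh k n) : EqCoh k n where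
  carrier := ∀ i, (X i).carrier
  piece q := AddSubgroup.pi Set.univ fun i => (X i).piece q
  isInternal := by
    classical
    refine isInternal_of_proj _
      (fun q => ⟨⟨fun x i => (X i).proj q (x i), funext fun i => map_zero _⟩,
        fun x y => funext fun i => map_add _ _ _⟩) ?_ ?_ ?_ ?_
    · exact fun q x i _ => (X i).proj_mem q (x i)
    · exact fun q x hx => funext fun i => (X i).proj_self q _ (hx i trivial)
    · exact fun q r h x hx => funext fun i => (X i).proj_ne q r h _ (hx i trivial)
    · intro x
      choose s hs using fun i => (X i).proj_sum (x i)
      refine ⟨Finset.univ.biUnion s, funext fun i => ?_⟩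
      rw [Finset.sum_apply]
      exact (X i).eq_sum_proj_of_subset _ (hs i)
        (Finset.subset_biUnion_of_mem s (Finset.mem_univ i))
  smul_mem r q f x hf hx i _ := (X i).smul_mem r q f (x i) hf (hx i trivial)

/-- The graded free module with one generator in each degree `e ∈ s`. -/
def free (k : Type u) [Field k] {n : ℕ} (s : Finset (Fin n → ℤ)) : EqCoh k n where
  carrier := s → PolyRing k n
  piece q := AddSubgroup.pi Set.univ fun e => (polyPiece k n (q - e.1)).toAddSubgroup
  isInternal := (pi fun e : s => lineBundle k e.1).isInternal
  smul_mem := (pi fun e : s => lineBundle k e.1).smul_mem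

/-- The coefficient at the generator of degree `e`, zero if there is no such generator. -/
def coeff (s : Finset (Fin n → ℤ)) (e : Fin n → ℤ) :
    (free k s).carrier →ₗ[PolyRing k n] PolyRing k n where
  toFun x := if h : e ∈ s then (x : s → PolyRing k n) ⟨e, h⟩ else 0
  map_add' x y := by
    split_ifs
    · rfl
    · rw [add_zero]
  map_smul' c x := by
    split_ifs
    · rfl
    · rw [smul_zero]

/-- The element with prescribed coefficients. -/
def ofCoeff (s : Finset (Fin n → ℤ)) (c : (Fin n → ℤ) → PolyRing k n) : (free k s).carrier :=
  fun e => c e.1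

/-- The generator of degree `e`, zero if there is no such generator. -/
def gen (s : Finset (Fin n → ℤ)) (e : Fin n → ℤ) : (free k s).carrier :=
  ofCoeff s (Pi.single e 1)

theorem coeff_of_mem {s : Finset (Fin n → ℤ)} {e : Fin n → ℤ} (h : e ∈ s)
    (x : (free k s).carrier) : coeff s e x = (x : s → PolyRing k n) ⟨e, h⟩ :=
  dif_pos h

theorem coeff_of_notMem {s : Finset (Fin n → ℤ)} {e : Fin n → ℤ} (h : e ∉ s)
    (x : (free k s).carrier) : coeff s e x = 0 :=
  dif_neg h

theorem coeff_ofCoeff {s : Finset (Fin n → ℤ)} {e : Fin n → ℤ} (h : e ∈ s)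
    (c : (Fin n → ℤ) → PolyRing k n) : coeff s e (ofCoeff s c) = c e :=
  coeff_of_mem h _

theorem coeff_gen_self {s : Finset (Fin n → ℤ)} {e : Fin n → ℤ} (h : e ∈ s) :
    coeff s e (gen s e) = (1 : PolyRing k n) := by
  rw [gen, coeff_ofCoeff h, Pi.single_eq_same]

theorem free_ext {s : Finset (Fin n → ℤ)} {x y : (free k s).carrier}
    (h : ∀ e ∈ s, coeff s e x = coeff s e y) : x = y := by
  funext e
  have := h e.1 e.2
  rwa [coeff_of_mem e.2, coeff_of_mem e.2] at this

theorem mem_piece_free {s : Finset (Fin n → ℤ)} {q : Fin n → ℤ} {x : (free k s).carrier} :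
    x ∈ (free k s).piece q ↔ ∀ e ∈ s, coeff s e x ∈ polyPiece k n (q - e) := by
  constructor
  · intro h e he
    rw [coeff_of_mem he]
    exact h ⟨e, he⟩ trivial
  · intro h e _
    have := h e.1 e.2
    rwa [coeff_of_mem e.2] at this

theorem coeff_mem {s : Finset (Fin n → ℤ)} {q : Fin n → ℤ} {x : (free k s).carrier}
    (hx : x ∈ (free k s).piece q) (e : Fin n → ℤ) : coeff s e x ∈ polyPiece k n (q - e) := by
  by_cases he : e ∈ s
  · exact mem_piece_free.1 hx e he
  · rw [coeff_of_notMem he]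
    exact Submodule.zero_mem _

theorem gen_of_notMem {s : Finset (Fin n → ℤ)} {e : Fin n → ℤ} (h : e ∉ s) :
    gen s e = (0 : (free k s).carrier) := by
  refine free_ext fun e' he' => ?_
  rw [gen, coeff_ofCoeff he', map_zero, Pi.single_eq_of_ne]
  rintro rfl
  exact h he'

theorem one_mem_polyPiece : (1 : PolyRing k n) ∈ polyPiece k n 0 :=
  MvPolynomial.isWeightedHomogeneous_one _ _

theorem X_mem_polyPiece (i : Fin n) :
    (MvPolynomial.X i : PolyRing k n) ∈ polyPiece k n (Pi.single i 1) :=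
  MvPolynomial.isWeightedHomogeneous_X _ _ _

theorem gen_mem (s : Finset (Fin n → ℤ)) (e : Fin n → ℤ) :
    gen s e ∈ (free k s).piece e := by
  rw [mem_piece_free]
  intro e' he'
  rw [gen, coeff_ofCoeff he']
  by_cases h : e' = e
  · subst h
    rw [Pi.single_eq_same, sub_self]
    exact one_mem_polyPiece
  · rw [Pi.single_eq_of_ne h]
    exact Submodule.zero_mem _

theorem eq_sum_gen {s : Finset (Fin n → ℤ)} (x : (free k s).carrier) :
    x = ∑ e ∈ s, coeff s e x • gen s e := by
  refine free_ext fun e he => ?_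
  rw [map_sum, Finset.sum_eq_single_of_mem e he]
  · rw [map_smul, coeff_gen_self he, smul_eq_mul, mul_one]
  · intro e' _ h
    rw [map_smul, gen, coeff_ofCoeff he, Pi.single_eq_of_ne h.symm, smul_zero]

theorem free_hom_ext {s : Finset (Fin n → ℤ)} {Y : EqCoh k n} {f g : free k s ⟶ Y}
    (h : ∀ e ∈ s, f.toLin (gen s e) = g.toLin (gen s e)) : f = g := by
  ext x
  rw [eq_sum_gen x, map_sum, map_sum]
  refine Finset.sum_congr rfl fun e he => ?_
  rw [map_smul, map_smul, h e he]

/-- The morphism from a graded free module with prescribed values on the generators. -/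
def freeHom {s : Finset (Fin n → ℤ)} {Y : EqCoh k n} (y : (Fin n → ℤ) → Y.carrier)
    (hy : ∀ e ∈ s, y e ∈ Y.piece e) : free k s ⟶ Y where
  toLin := ∑ e ∈ s, (coeff s e).smulRight (y e)
  map_mem q x hx := by
    rw [LinearMap.sum_apply]
    refine AddSubgroup.sum_mem _ fun e he => ?_
    have := Y.smul_mem _ _ _ _ (coeff_mem hx e) (hy e he)
    rwa [sub_add_cancel] at this

theorem freeHom_gen {s : Finset (Fin n → ℤ)} {Y : EqCoh k n} (y : (Fin n → ℤ) → Y.carrier)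
    (hy : ∀ e ∈ s, y e ∈ Y.piece e) {e : Fin n → ℤ} (he : e ∈ s) :
    (freeHom y hy).toLin (gen s e) = y e := by
  change (∑ e ∈ s, (coeff s e).smulRight (y e)) (gen s e) = y e
  rw [LinearMap.sum_apply, Finset.sum_eq_single_of_mem e he]
  · rw [LinearMap.smulRight_apply, coeff_gen_self he, one_smul]
  · intro e' he' h
    rw [LinearMap.smulRight_apply, gen, coeff_ofCoeff he', Pi.single_eq_of_ne h, zero_smul]

/-- A surjective graded map is surjective in each degree, so the images of the generators lift to
homogeneous elements of the right degrees. -/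
instance (s : Finset (Fin n → ℤ)) : Projective (free k s) where
  factors {E X} f g _ := by
    choose! y hy hgy using fun (e : Fin n → ℤ) (_ : e ∈ s) =>
      exists_of_surjective g (surjective_of_epi g) (f.map_mem e _ (gen_mem s e))
    refine ⟨freeHom y hy, free_hom_ext fun e he => ?_⟩
    rw [comp_apply, freeHom_gen y hy he, hgy e he]

/-! ### The Koszul differential -/

theorem sum_pi_single_apply (s : Finset (Fin n)) (i : Fin n) (c : ℤ) :
    ∑ j ∈ s, (Pi.single i c : Fin n → ℤ) j = if i ∈ s then c else 0 := by
  simp only [Pi.single_apply]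
  exact Finset.sum_ite_eq' s i fun _ => c

/-- The sign of the `i`-th component of the Koszul differential on the generator of degree `e`. -/
def koszulSign (e : Fin n → ℤ) (i : Fin n) : ℤˣ := (∑ j ∈ Finset.Iio i, e j).negOnePow

theorem koszulSign_add_single_of_le (e : Fin n → ℤ) {i j : Fin n} (h : i ≤ j) (c : ℤ) :
    koszulSign (e + Pi.single j c) i = koszulSign e i := by
  unfold koszulSign
  congr 1
  refine Finset.sum_congr rfl fun l hl => ?_
  rw [Pi.add_apply, Pi.single_eq_of_ne (by rw [Finset.mem_Iio] at hl; exact (hl.trans_le h).ne),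
    add_zero]

theorem koszulSign_add_single_of_lt (e : Fin n → ℤ) {i j : Fin n} (h : j < i) :
    koszulSign (e + Pi.single j 1) i = - koszulSign e i := by
  unfold koszulSign
  simp only [Pi.add_apply]
  rw [Finset.sum_add_distrib, sum_pi_single_apply, if_pos (Finset.mem_Iio.2 h),
    Int.negOnePow_succ]

theorem koszulSign_add_single_self (e : Fin n → ℤ) (i : Fin n) :
    koszulSign (e + Pi.single i 1) i = koszulSign e i :=
  koszulSign_add_single_of_le e le_rfl 1

theorem koszulSign_sub_single_self (e : Fin n → ℤ) (i : Fin n) :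
    koszulSign (e - Pi.single i 1) i = koszulSign e i := by
  rw [← koszulSign_add_single_self (e - Pi.single i 1) i, sub_add_cancel]

/-- The sign in direction i counts the total degree in the coordinates below i. Of two distinct
directions exactly one is below the other, so exactly one of the two signs flips. -/
theorem koszulSign_anticomm (e : Fin n → ℤ) {i j : Fin n} (h : i ≠ j) :
    koszulSign (e + Pi.single j 1) i * koszulSign e j =
      - (koszulSign (e + Pi.single i 1) j * koszulSign e i) := by
  rcases lt_or_gt_of_ne h with h | h
  · rw [koszulSign_add_single_of_le e h.le, koszulSign_add_single_of_lt e h, neg_mul, neg_neg,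
      mul_comm]
  · rw [koszulSign_add_single_of_le e h.le, koszulSign_add_single_of_lt e h, neg_mul, mul_comm]

/-- The Koszul differential between the graded free modules on `s` and `t`. -/
def koszulD (k : Type u) [Field k] {n : ℕ} (s t : Finset (Fin n → ℤ)) : free k s ⟶ free k t where
  toLin := LinearMap.pi fun e : t => ∑ i, (koszulSign e.1 i • (MvPolynomial.X i : PolyRing k n)) •
    coeff s (e.1 + Pi.single i 1)
  map_mem q x hx := by
    intro e _
    change (LinearMap.pi _ : _ →ₗ[PolyRing k n] (t → PolyRing k n)) x e ∈ polyPiece k n (q - e.1)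
    rw [LinearMap.pi_apply, LinearMap.sum_apply]
    refine Submodule.sum_mem _ fun i _ => ?_
    rw [LinearMap.smul_apply, smul_eq_mul, Units.smul_def, smul_mul_assoc]
    refine zsmul_mem ?_ _
    have := MvPolynomial.IsWeightedHomogeneous.mul (X_mem_polyPiece i)
      (coeff_mem hx (e.1 + Pi.single i 1))
    rwa [show (Pi.single i 1 : Fin n → ℤ) + (q - (e.1 + Pi.single i 1)) = q - e.1 by abel] at this

theorem coeff_koszulD {s t : Finset (Fin n → ℤ)} {e : Fin n → ℤ} (he : e ∈ t)
    (x : (free k s).carrier) :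
    coeff t e ((koszulD k s t).toLin x) =
      ∑ i, koszulSign e i • (MvPolynomial.X i * coeff s (e + Pi.single i 1) x) := by
  rw [coeff_of_mem he]
  change (LinearMap.pi _ : _ →ₗ[PolyRing k n] (t → PolyRing k n)) x ⟨e, he⟩ = _
  rw [LinearMap.pi_apply, LinearMap.sum_apply]
  refine Finset.sum_congr rfl fun i _ => ?_
  rw [LinearMap.smul_apply, smul_eq_mul, Units.smul_def, smul_mul_assoc, Units.smul_def]

theorem koszulD_gen {s t : Finset (Fin n → ℤ)} {e : Fin n → ℤ} (he : e ∈ s) :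
    (koszulD k s t).toLin (gen s e) =
      ∑ i, koszulSign e i • ((MvPolynomial.X i : PolyRing k n) • gen t (e - Pi.single i 1)) := by
  refine free_ext fun e' he' => ?_
  rw [coeff_koszulD he', map_sum]
  refine Finset.sum_congr rfl fun i _ => ?_
  rw [Units.smul_def, Units.smul_def, map_zsmul, map_smul, smul_eq_mul]
  by_cases h : e' + Pi.single i 1 = e
  · subst h
    rw [coeff_gen_self he, add_sub_cancel_right, coeff_gen_self he', koszulSign_add_single_self]
  · have h1 : coeff s (e' + Pi.single i 1) (gen s e) = (0 : PolyRing k n) := by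
      by_cases hs : e' + Pi.single i 1 ∈ s
      · rw [gen, coeff_ofCoeff hs, Pi.single_eq_of_ne h]
      · exact coeff_of_notMem hs _
    rw [h1, gen, coeff_ofCoeff he', Pi.single_eq_of_ne (fun h' => h (by rw [h', sub_add_cancel])),
      mul_zero, smul_zero, smul_zero]

/-- The hypothesis says that two steps from `s` to `r` use different directions and pass through `t`
in either order. The two orders then cancel by `koszulSign_anticomm`. -/
theorem koszulD_comp {s t r : Finset (Fin n → ℤ)}
    (h : ∀ e ∈ r, ∀ i j, e + Pi.single i 1 + Pi.single j 1 ∈ s →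
      i ≠ j ∧ e + Pi.single i 1 ∈ t) :
    koszulD k s t ≫ koszulD k t r = 0 := by
  ext x
  refine free_ext fun e he => ?_
  rw [comp_apply, coeff_koszulD he, zero_apply, map_zero]
  have h1 : ∀ i, koszulSign e i • ((MvPolynomial.X i : PolyRing k n) *
      coeff t (e + Pi.single i 1) ((koszulD k s t).toLin x)) =
      ∑ j, (koszulSign (e + Pi.single i 1) j * koszulSign e i) •
        (MvPolynomial.X i * MvPolynomial.X j *
          coeff s (e + Pi.single i 1 + Pi.single j 1) x) := by
    intro i
    by_cases hi : e + Pi.single i 1 ∈ t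
    · rw [coeff_koszulD hi, Finset.mul_sum, Finset.smul_sum]
      refine Finset.sum_congr rfl fun j _ => ?_
      rw [mul_smul_comm, smul_smul, mul_comm (koszulSign e i), mul_assoc]
    · rw [coeff_of_notMem hi, mul_zero, smul_zero]
      refine (Finset.sum_eq_zero fun j _ => ?_).symm
      rw [coeff_of_notMem fun hs => hi (h e he i j hs).2, mul_zero, smul_zero]
  rw [Finset.sum_congr rfl fun i _ => h1 i, ← Finset.sum_product']
  -- Pairs (i, j) and (j, i) cancel; a diagonal pair vanishes by itself, since its generator is not
  -- in `s`.
  refine Finset.sum_involution (fun p _ => p.swap) ?_ ?_ (fun _ _ => Finset.mem_univ _)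
    (fun _ _ => rfl)
  · rintro ⟨i, j⟩ _
    by_cases hij : i = j
    · subst hij
      dsimp only [Prod.swap]
      rw [coeff_of_notMem fun hs => (h e he i i hs).1 rfl, mul_zero, smul_zero, add_zero]
    · dsimp only [Prod.swap]
      rw [koszulSign_anticomm e (Ne.symm hij), mul_comm (MvPolynomial.X j),
        add_right_comm e (Pi.single j 1), Units.smul_def,
        Units.smul_def, Units.val_neg, neg_smul, neg_add_cancel]
  · rintro ⟨i, j⟩ _ h0 heq
    have hij : j = i := congrArg Prod.fst heq
    subst hij
    exact h0 (by rw [coeff_of_notMem fun hs => (h e he j j hs).1 rfl, mul_zero, smul_zero])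

/-- The degrees of the generators of the Koszul resolution of `𝒪_{I,p}`. -/
def koszulBox {n : ℕ} (I : Finset (Fin n)) (p : Fin n → ℤ) : Finset (Fin n → ℤ) :=
  Fintype.piFinset fun i => if i ∈ I then {p i, p i + 1} else {p i}

theorem mem_koszulBox {I : Finset (Fin n)} {p e : Fin n → ℤ} :
    e ∈ koszulBox I p ↔ ∀ i, e i = p i ∨ (i ∈ I ∧ e i = p i + 1) := by
  rw [koszulBox, Fintype.mem_piFinset]
  refine forall_congr' fun i => ?_
  split_ifs with h <;> simp [h]

/-- The degrees of the generators in cohomological degree `m`. -/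
def koszulDeg {n : ℕ} (I : Finset (Fin n)) (p : Fin n → ℤ) (m : ℤ) : Finset (Fin n → ℤ) :=
  {e ∈ koszulBox I p | ∑ i, e i = -m}

theorem mem_koszulDeg {I : Finset (Fin n)} {p e : Fin n → ℤ} {m : ℤ} :
    e ∈ koszulDeg I p m ↔ e ∈ koszulBox I p ∧ ∑ i, e i = -m := Finset.mem_filter

theorem sum_add_single (e : Fin n → ℤ) (i : Fin n) (c : ℤ) :
    ∑ j, (e + Pi.single i c : Fin n → ℤ) j = ∑ j, e j + c := by
  simp only [Pi.add_apply]
  rw [Finset.sum_add_distrib, sum_pi_single_apply, if_pos (Finset.mem_univ i)]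

/-- For i ∈ I the box is a product with {p_i, p_i + 1}. This pairing of its two opposite faces
carries the contracting homotopies in direction i. -/
theorem add_single_mem_koszulDeg_iff {I : Finset (Fin n)} {p e : Fin n → ℤ} {i : Fin n}
    (hi : i ∈ I) (he : e i = p i) {l m : ℤ} (hl : l + 1 = m) :
    e + Pi.single i 1 ∈ koszulDeg I p l ↔ e ∈ koszulDeg I p m := by
  rw [mem_koszulDeg, mem_koszulDeg, sum_add_single]
  refine and_congr ?_ (by omega)
  rw [mem_koszulBox, mem_koszulBox]
  refine forall_congr' fun j => ?_
  by_cases hj : j = i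
  · subst hj
    rw [Pi.add_apply, Pi.single_eq_same, he]
    simp [hi]
  · rw [Pi.add_apply, Pi.single_eq_of_ne hj, add_zero]

/-- The Koszul complex of `𝒪_{I,p}`, with the generators of total degree `d` in cohomological
degree `-d`. -/
def koszul (k : Type u) [Field k] {n : ℕ} (I : Finset (Fin n)) (p : Fin n → ℤ) :
    CochainComplex (EqCoh k n) ℤ where
  X m := free k (koszulDeg I p m)
  d i j := if i + 1 = j then koszulD k _ _ else 0
  shape i j h := if_neg h
  d_comp_d' i j l hij hjl := by
    rw [if_pos (show i + 1 = j from hij), if_pos (show j + 1 = l from hjl)]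
    refine koszulD_comp fun e he i' j' hs => ?_
    rw [mem_koszulDeg] at he hs
    have h1 := mem_koszulBox.1 he.1
    have h2 := mem_koszulBox.1 hs.1
    -- The box has width at most one in each direction, so the same direction cannot be used twice,
    -- and the intermediate point agrees in each coordinate with one of the two ends.
    refine ⟨?_, mem_koszulDeg.2 ⟨mem_koszulBox.2 fun a => ?_, ?_⟩⟩
    · rintro rfl
      have h1 := h1 i'
      have h2 := h2 i'
      simp only [Pi.add_apply, Pi.single_eq_same] at h2
      omega
    · have h1 := h1 a
      have h2 := h2 a
      by_cases hj : a = j'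
      · subst hj
        by_cases hi : a = i'
        · subst hi
          simp only [Pi.add_apply, Pi.single_eq_same] at h2 ⊢
          omega
        · simpa only [Pi.add_apply, Pi.single_eq_of_ne hi, add_zero] using h1
      · simpa only [Pi.add_apply, Pi.single_eq_of_ne hj, add_zero] using h2
    · have := hs.2
      have hij' : i + 1 = j := hij
      rw [sum_add_single] at this
      omega

theorem koszul_d {I : Finset (Fin n)} {p : Fin n → ℤ} {i j : ℤ} (h : i + 1 = j) :
    (koszul k I p).d i j = koszulD k (koszulDeg I p i) (koszulDeg I p j) := if_pos h

end EqCoh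

noncomputable section

namespace EqCoh

variable {k : Type u} [Field k] {n : ℕ}

/-! ### The multigraded pieces of the polynomial ring -/

theorem weight_single_apply (d : Fin n →₀ ℕ) (i : Fin n) :
    Finsupp.weight (fun i : Fin n => (Pi.single i 1 : Fin n → ℤ)) d i = d i := by
  rw [Finsupp.weight_eq_sum, Finset.sum_apply, Finset.sum_eq_single i]
  · rw [Pi.smul_apply, Pi.single_eq_same, nsmul_eq_mul, mul_one]
  · intro j _ hj
    rw [Pi.smul_apply, Pi.single_eq_of_ne hj.symm, smul_zero]
  · exact fun h => absurd (Finset.mem_univ i) h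

theorem mem_polyPiece {f : PolyRing k n} {r : Fin n → ℤ} :
    f ∈ polyPiece k n r ↔ ∀ d ∈ f.support, ∀ i, (d i : ℤ) = r i := by
  refine forall_congr' fun d => imp_congr MvPolynomial.mem_support_iff.symm ?_
  rw [funext_iff]
  exact forall_congr' fun i => by rw [weight_single_apply]

/-- The degree determines every exponent, so the pieces are at most one-dimensional and questions
about homogeneous elements become questions about monomials. -/
theorem exists_eq_monomial {f : PolyRing k n} {r : Fin n → ℤ} (hf : f ∈ polyPiece k n r)
    (h0 : f ≠ 0) : ∃ (d : Fin n →₀ ℕ) (c : k), (∀ i, (d i : ℤ) = r i) ∧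
      f = MvPolynomial.monomial d c := by
  rw [mem_polyPiece] at hf
  obtain ⟨d, hd⟩ := MvPolynomial.support_nonempty.2 h0
  refine ⟨d, f.coeff d, hf d hd, ?_⟩
  have hs : f.support = {d} := by
    refine Finset.eq_singleton_iff_unique_mem.2 ⟨hd, fun d' hd' => Finsupp.ext fun i => ?_⟩
    have h1 := hf d hd i
    have h2 := hf d' hd' i
    omega
  conv_lhs => rw [← MvPolynomial.support_sum_monomial_coeff f, hs, Finset.sum_singleton]

theorem monomial_mem_polyPiece {d : Fin n →₀ ℕ} {r : Fin n → ℤ} (h : ∀ i, (d i : ℤ) = r i)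
    (c : k) : MvPolynomial.monomial d c ∈ polyPiece k n r := by
  refine mem_polyPiece.2 fun d' hd' => ?_
  rw [Finset.mem_singleton.1 (MvPolynomial.support_monomial_subset hd')]
  exact h

theorem eq_zero_of_mem_polyPiece {f : PolyRing k n} {r : Fin n → ℤ} (hf : f ∈ polyPiece k n r)
    {i : Fin n} (hi : r i < 0) : f = 0 := by
  by_contra h0
  obtain ⟨d, c, hd, _⟩ := exists_eq_monomial hf h0
  have := hd i
  omega

theorem exists_X_mul_eq {f : PolyRing k n} {r : Fin n → ℤ} {i : Fin n}
    (hf : f ∈ polyPiece k n (r + Pi.single i 1)) (hi : 0 ≤ r i) :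
    ∃ g ∈ polyPiece k n r, MvPolynomial.X i * g = f := by
  by_cases h0 : f = 0
  · exact ⟨0, Submodule.zero_mem _, by rw [h0, mul_zero]⟩
  obtain ⟨d, c, hd, rfl⟩ := exists_eq_monomial hf h0
  have hdi : Finsupp.single i 1 ≤ d := by
    rw [Finsupp.single_le_iff]
    have := hd i
    rw [Pi.add_apply, Pi.single_eq_same] at this
    omega
  refine ⟨MvPolynomial.monomial (d - Finsupp.single i 1) c, ?_, ?_⟩
  · refine monomial_mem_polyPiece (fun j => ?_) c
    have hj := hd j
    have hle := hdi j
    rw [Finsupp.tsub_apply]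
    by_cases h : j = i
    · subst h
      rw [Pi.add_apply, Pi.single_eq_same] at hj
      rw [Finsupp.single_eq_same] at hle ⊢
      omega
    · rw [Pi.add_apply, Pi.single_eq_of_ne h] at hj
      rw [Finsupp.single_eq_of_ne h]
      omega
  · rw [MvPolynomial.X, MvPolynomial.monomial_mul, one_mul, add_tsub_cancel_of_le hdi]

/-! ### The sheaves `𝒪_{I,p}` -/

/-- The class of a polynomial in `𝒪_{I,p}`. -/
def strMk (I : Finset (Fin n)) (p : Fin n → ℤ) :
    PolyRing k n →ₗ[PolyRing k n] (strSheaf k I p).carrier :=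
  Submodule.mkQ (Ideal.span (MvPolynomial.X '' (I : Set (Fin n))) : Ideal (PolyRing k n))

theorem strMk_surjective (I : Finset (Fin n)) (p : Fin n → ℤ) :
    Function.Surjective (strMk (k := k) I p) := Submodule.mkQ_surjective _

theorem strMk_eq_zero {I : Finset (Fin n)} {p : Fin n → ℤ} {f : PolyRing k n} :
    strMk I p f = 0 ↔ ∀ m ∈ f.support, ∃ i ∈ I, m i ≠ 0 :=
  (Submodule.Quotient.mk_eq_zero _).trans MvPolynomial.mem_ideal_span_X_image

theorem mem_piece_strSheaf {I : Finset (Fin n)} {p q : Fin n → ℤ}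
    {y : (strSheaf k I p).carrier} :
    y ∈ (strSheaf k I p).piece q ↔ ∃ f ∈ polyPiece k n (q - p), strMk I p f = y := Iff.rfl

theorem X_smul_strSheaf_eq_zero {I : Finset (Fin n)} {p : Fin n → ℤ} {i : Fin n} (hi : i ∈ I)
    (y : (strSheaf k I p).carrier) : (MvPolynomial.X i : PolyRing k n) • y = 0 := by
  obtain ⟨f, rfl⟩ := strMk_surjective I p y
  rw [← map_smul]
  refine strMk_eq_zero.2 fun m hm => ⟨i, hi, ?_⟩
  rw [smul_eq_mul, MvPolynomial.support_X_mul] at hm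
  obtain ⟨m', -, rfl⟩ := Finset.mem_map.1 hm
  simp

theorem X_smul_strSheaf_injective {I : Finset (Fin n)} {p : Fin n → ℤ} {i : Fin n} (hi : i ∉ I)
    {y : (strSheaf k I p).carrier} (hy : (MvPolynomial.X i : PolyRing k n) • y = 0) : y = 0 := by
  obtain ⟨f, rfl⟩ := strMk_surjective I p y
  rw [← map_smul] at hy
  refine strMk_eq_zero.2 fun m hm => ?_
  obtain ⟨j, hj, h⟩ := strMk_eq_zero.1 hy (Finsupp.single i 1 + m) (by
    rw [smul_eq_mul, MvPolynomial.support_X_mul]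
    exact Finset.mem_map_of_mem _ hm)
  refine ⟨j, hj, ?_⟩
  rwa [Finsupp.add_apply, Finsupp.single_eq_of_ne (by rintro rfl; exact hi hj), zero_add] at h

/-- With `X_smul_strSheaf_injective` this makes z_i bijective from degree q to degree q + ε_i when i
∉ I and p_i ≤ q_i. -/
theorem exists_X_smul_strSheaf_eq {I : Finset (Fin n)} {p q : Fin n → ℤ} {i : Fin n}
    {y : (strSheaf k I p).carrier} (hy : y ∈ (strSheaf k I p).piece (q + Pi.single i 1))
    (hi : p i ≤ q i) :
    ∃ z ∈ (strSheaf k I p).piece q, (MvPolynomial.X i : PolyRing k n) • z = y := by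
  obtain ⟨f, hf, rfl⟩ := mem_piece_strSheaf.1 hy
  rw [add_sub_right_comm] at hf
  obtain ⟨g, hg, rfl⟩ := exists_X_mul_eq hf (sub_nonneg.2 hi)
  exact ⟨strMk I p g, mem_piece_strSheaf.2 ⟨g, hg, rfl⟩, (map_smul _ _ _).symm⟩

theorem strSheaf_piece_eq_zero {I : Finset (Fin n)} {p q : Fin n → ℤ}
    {y : (strSheaf k I p).carrier} (hy : y ∈ (strSheaf k I p).piece q) {i : Fin n}
    (hi : q i < p i ∨ i ∈ I ∧ q i ≠ p i) : y = 0 := by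
  obtain ⟨f, hf, rfl⟩ := mem_piece_strSheaf.1 hy
  rcases hi with hi | ⟨hi, hne⟩
  · rw [eq_zero_of_mem_polyPiece hf (sub_neg.2 hi), map_zero]
  · refine strMk_eq_zero.2 fun m hm => ⟨i, hi, fun h0 => hne ?_⟩
    have := mem_polyPiece.1 hf m hm i
    rw [h0, Pi.sub_apply] at this
    omega

/-- The generator of `𝒪_{I,p}`. -/
def strOne (k : Type u) [Field k] {n : ℕ} (I : Finset (Fin n)) (p : Fin n → ℤ) :
    (strSheaf k I p).carrier := strMk I p 1

theorem exists_eq_C_smul_strOne {I : Finset (Fin n)} {p : Fin n → ℤ}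
    {y : (strSheaf k I p).carrier} (hy : y ∈ (strSheaf k I p).piece p) :
    ∃ c : k, y = (MvPolynomial.C c : PolyRing k n) • strOne k I p := by
  obtain ⟨f, hf, rfl⟩ := mem_piece_strSheaf.1 hy
  by_cases h0 : f = 0
  · exact ⟨0, by rw [h0, map_zero, map_zero, zero_smul]⟩
  obtain ⟨d, c, hd, rfl⟩ := exists_eq_monomial hf h0
  refine ⟨c, ?_⟩
  obtain rfl : d = 0 := Finsupp.ext fun i => by
    have := hd i
    rw [sub_self, Pi.zero_apply] at this
    exact_mod_cast this
  rw [strOne, ← map_smul, smul_eq_mul, mul_one]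
  rfl

theorem strOne_mem (I : Finset (Fin n)) (p : Fin n → ℤ) : strOne k I p ∈ (strSheaf k I p).piece p :=
  mem_piece_strSheaf.2 ⟨1, by rw [sub_self]; exact one_mem_polyPiece, rfl⟩

theorem strOne_ne_zero (I : Finset (Fin n)) (p : Fin n → ℤ) : strOne k I p ≠ 0 := by
  intro h
  obtain ⟨i, -, hi⟩ := strMk_eq_zero.1 h 0 (by
    rw [MvPolynomial.mem_support_iff, MvPolynomial.coeff_zero_one]
    exact one_ne_zero)
  exact hi rfl

/-- The projection of a graded free module to `𝒪_{I,p}` via the coefficient in degree `p`. -/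
def aug (k : Type u) [Field k] {n : ℕ} (s : Finset (Fin n → ℤ)) (I : Finset (Fin n))
    (p : Fin n → ℤ) : free k s ⟶ strSheaf k I p where
  toLin := (strMk I p).comp (coeff s p)
  map_mem _ _ hx := mem_piece_strSheaf.2 ⟨_, coeff_mem hx p, rfl⟩

theorem aug_apply {s : Finset (Fin n → ℤ)} {I : Finset (Fin n)} {p : Fin n → ℤ}
    (x : (free k s).carrier) : (aug k s I p).toLin x = strMk I p (coeff s p x) := rfl

/-! ### Exactness -/

theorem epi_of_surjective {X Y : EqCoh k n} (f : X ⟶ Y) (hf : Function.Surjective f.toLin) :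
    Epi f where
  left_cancellation g h hgh := by
    ext y
    obtain ⟨x, rfl⟩ := hf y
    exact congrArg (fun t => t.toLin x) hgh

theorem mono_of_injective {X Y : EqCoh k n} (f : X ⟶ Y) (hf : Function.Injective f.toLin) :
    Mono f where
  right_cancellation g h hgh := by
    ext x
    exact hf (congrArg (fun t => t.toLin x) hgh)

theorem exact_of_forall (S : ShortComplex (EqCoh k n))
    (h : ∀ y, S.g.toLin y = 0 → ∃ x, S.f.toLin x = y) : S.Exact := by
  rw [ShortComplex.exact_iff_epi_kernel_lift]
  refine epi_of_surjective _ fun y => ?_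
  have hy : S.g.toLin ((kernel.ι S.g).toLin y) = 0 :=
    congrArg (fun t => t.toLin y) (kernel.condition S.g)
  obtain ⟨x, hx⟩ := h _ hy
  refine ⟨x, injective_of_mono (kernel.ι S.g) ?_⟩
  rw [← hx, ← comp_apply, kernel.lift_ι]

/-- The kernel is homogeneous, so preimages of the finitely many components can be found separately
and added. -/
theorem exact_of_forall_piece (S : ShortComplex (EqCoh k n))
    (h : ∀ q, ∀ y ∈ S.X₂.piece q, S.g.toLin y = 0 → ∃ x, S.f.toLin x = y) : S.Exact := by
  refine exact_of_forall S fun y hy => ?_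
  choose x hx using fun q => h q (S.X₂.proj q y) (S.X₂.proj_mem q y)
    (by rw [toLin_proj, hy, map_zero])
  obtain ⟨s, hs⟩ := S.X₂.proj_sum y
  refine ⟨∑ q ∈ s, x q, ?_⟩
  rw [map_sum, Finset.sum_congr rfl fun q _ => hx q]
  exact hs.symm

/-! ### Exactness of the Koszul complex -/

/-- In a degree q with q_i > p_i, division by z_i is possible on the face e_i = p_i and gives a
contracting homotopy in direction i. -/
theorem koszul_exact_of_lt {I : Finset (Fin n)} {p q : Fin n → ℤ} {i : Fin n} (hi : i ∈ I)
    (hq : p i < q i) {l m m' : ℤ} (hl : l + 1 = m) (hm : m + 1 = m')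
    {x : (free k (koszulDeg I p m)).carrier}
    (hx : x ∈ (free k (koszulDeg I p m)).piece q)
    (h0 : (koszulD k (koszulDeg I p m) (koszulDeg I p m')).toLin x = 0) :
    ∃ y, (koszulD k (koszulDeg I p l) (koszulDeg I p m)).toLin y = x := by
  -- The coefficient at e has degree q - e, whose i-th entry is q_i - p_i ≥ 1, so z_i divides it.
  have hdiv : ∀ e : Fin n → ℤ, ∃ g : PolyRing k n, e i = p i →
      MvPolynomial.X i * g = koszulSign e i • coeff (koszulDeg I p m) e x := by
    intro e
    by_cases he : e i = p i
    · have h1 : koszulSign e i • coeff (koszulDeg I p m) e x ∈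
          polyPiece k n ((q - e - Pi.single i 1) + Pi.single i 1) := by
        rw [sub_add_cancel, Units.smul_def]
        exact zsmul_mem (coeff_mem hx e) _
      obtain ⟨g, -, hg⟩ := exists_X_mul_eq h1 (by
        rw [Pi.sub_apply, Pi.sub_apply, Pi.single_eq_same]
        omega)
      exact ⟨g, fun _ => hg⟩
    · exact ⟨0, fun h => absurd h he⟩
  choose g hg using hdiv
  -- The preimage lives on the face e_i = p_i + 1, with the quotient taken from the opposite
  -- generator. On the face e_i = p_i the differential then sees only direction i and returns x.
  let y : (free k (koszulDeg I p l)).carrier := ofCoeff _ fun e =>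
    if e i = p i then 0 else g (e - Pi.single i 1)
  refine ⟨y, free_ext fun e he => ?_⟩
  rw [coeff_koszulD he]
  have hebox := mem_koszulBox.1 (mem_koszulDeg.1 he).1
  have hysupp : ∀ (e' : Fin n → ℤ), e' i = p i → coeff (koszulDeg I p l) e' y = 0 := by
    intro e' he'
    by_cases hm : e' ∈ koszulDeg I p l
    · rw [coeff_ofCoeff hm, if_pos he']
    · exact coeff_of_notMem hm _
  have hyval : ∀ (e' : Fin n → ℤ), e' i = p i →
      MvPolynomial.X i * coeff (koszulDeg I p l) (e' + Pi.single i 1) y =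
        koszulSign e' i • coeff (koszulDeg I p m) e' x := by
    intro e' he'
    have hne : ¬ (e' + Pi.single i 1 : Fin n → ℤ) i = p i := by
      rw [Pi.add_apply, Pi.single_eq_same]
      omega
    have hiff := add_single_mem_koszulDeg_iff hi he' hl
    by_cases hm : e' + Pi.single i 1 ∈ koszulDeg I p l
    · rw [coeff_ofCoeff hm, if_neg hne, add_sub_cancel_right, hg e' he']
    · rw [coeff_of_notMem hm, coeff_of_notMem (fun h => hm (hiff.2 h)), mul_zero, smul_zero]
  rcases hebox i with hei | ⟨-, hei⟩
  · rw [Finset.sum_eq_single i, hyval e hei, smul_smul, Int.units_mul_self, one_smul]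
    · intro j _ hj
      rw [hysupp, mul_zero, smul_zero]
      rw [Pi.add_apply, Pi.single_eq_of_ne hj.symm, add_zero, hei]
    · exact fun h => absurd (Finset.mem_univ i) h
  -- On the face e_i = p_i + 1 the cocycle condition at e - ε_i is needed. Multiplying by z_i undoes
  -- the division so that the two can be compared.
  · refine mul_left_cancel₀ (MvPolynomial.X_ne_zero i) ?_
    have he' : e - Pi.single i 1 ∈ koszulDeg I p m' := by
      rw [sub_eq_add_neg, ← Pi.single_neg, mem_koszulDeg, sum_add_single, mem_koszulBox]
      refine ⟨fun j => ?_, by rw [(mem_koszulDeg.1 he).2]; omega⟩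
      by_cases hj : j = i
      · subst hj
        rw [Pi.add_apply, Pi.single_eq_same]
        omega
      · rw [Pi.add_apply, Pi.single_eq_of_ne hj, add_zero]
        exact hebox j
    have h1 := coeff_koszulD he' x
    rw [h0, map_zero] at h1
    have hei' : (e - Pi.single i 1 : Fin n → ℤ) i = p i := by
      rw [Pi.sub_apply, Pi.single_eq_same]
      omega
    -- For j = i the left side vanishes, as e + ε_i is outside the box, and the cocycle equation
    -- contributes the wanted coefficient of x. For j ≠ i the terms agree up to the anticommutation
    -- sign.
    have hsum : ∀ j, MvPolynomial.X i * (koszulSign e j •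
        (MvPolynomial.X j * coeff (koszulDeg I p l) (e + Pi.single j 1) y)) =
        (if j = i then MvPolynomial.X i * coeff (koszulDeg I p m) e x else 0) -
          koszulSign e i • (koszulSign (e - Pi.single i 1) j •
          (MvPolynomial.X j * coeff (koszulDeg I p m) (e - Pi.single i 1 + Pi.single j 1) x)) := by
      intro j
      split_ifs with hj
      · subst hj
        rw [coeff_of_notMem, mul_zero, smul_zero, mul_zero, koszulSign_sub_single_self,
          sub_add_cancel, smul_smul,
          Int.units_mul_self, one_smul, sub_self]
        intro h
        have := mem_koszulBox.1 (mem_koszulDeg.1 h).1 j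
        rw [Pi.add_apply, Pi.single_eq_same] at this
        omega
      · have h2 := hyval (e - Pi.single i 1 + Pi.single j 1)
          (by rw [Pi.add_apply, Pi.single_eq_of_ne (Ne.symm hj), hei', add_zero])
        rw [add_right_comm, sub_add_cancel] at h2
        have h3 := koszulSign_anticomm (e - Pi.single i 1) (Ne.symm hj)
        rw [sub_add_cancel, koszulSign_sub_single_self] at h3
        have h4 : ∀ a b c d : ℤˣ, a * b = -(c * d) → c * a = -(d * b) := by decide
        rw [mul_smul_comm, mul_left_comm, h2, mul_smul_comm, smul_smul, smul_smul, zero_sub,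
          h4 _ _ _ _ h3, Units.smul_def, Units.smul_def, Units.val_neg, neg_smul]
    rw [Finset.mul_sum, Finset.sum_congr rfl fun j _ => hsum j, Finset.sum_sub_distrib,
      Finset.sum_ite_eq' Finset.univ i, if_pos (Finset.mem_univ i), ← Finset.smul_sum, ← h1,
      smul_zero, sub_zero]

end EqCoh

noncomputable section

namespace EqCoh

variable {k : Type u} [Field k] {n : ℕ}

/-! ### The Koszul resolution -/

theorem isZero_free_empty : IsZero (free k (∅ : Finset (Fin n → ℤ))) := by
  rw [IsZero.iff_id_eq_zero]
  exact free_hom_ext fun e he => absurd he (Finset.notMem_empty e)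

theorem le_of_mem_koszulDeg {I : Finset (Fin n)} {p e : Fin n → ℤ} {m : ℤ}
    (h : e ∈ koszulDeg I p m) : m ≤ -∑ i, p i := by
  rw [mem_koszulDeg, mem_koszulBox] at h
  have : ∑ i, p i ≤ ∑ i, e i := Finset.sum_le_sum fun i _ => by
    rcases h.1 i with h | ⟨-, h⟩ <;> omega
  omega

theorem koszulDeg_eq_empty {I : Finset (Fin n)} {p : Fin n → ℤ} {m : ℤ} (h : -∑ i, p i < m) :
    koszulDeg I p m = ∅ :=
  Finset.eq_empty_of_forall_notMem fun _ he => absurd (le_of_mem_koszulDeg he) (not_le.2 h)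

theorem eq_of_mem_koszulDeg {I : Finset (Fin n)} {p e : Fin n → ℤ}
    (h : e ∈ koszulDeg I p (-∑ i, p i)) : e = p := by
  rw [mem_koszulDeg, mem_koszulBox, neg_neg] at h
  have hle : ∀ i ∈ Finset.univ, p i ≤ e i := fun i _ => by
    rcases h.1 i with h | ⟨-, h⟩ <;> omega
  exact funext fun i => ((Finset.sum_eq_sum_iff_of_le hle).1 h.2.symm i (Finset.mem_univ i)).symm

theorem self_mem_koszulDeg (I : Finset (Fin n)) (p : Fin n → ℤ) :
    p ∈ koszulDeg I p (-∑ i, p i) :=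
  mem_koszulDeg.2 ⟨mem_koszulBox.2 fun _ => Or.inl rfl, (neg_neg _).symm⟩

instance (I : Finset (Fin n)) (p : Fin n → ℤ) (m : ℤ) : Projective ((koszul k I p).X m) :=
  inferInstanceAs (Projective (free k _))

instance (I : Finset (Fin n)) (p : Fin n → ℤ) :
    (koszul k I p).IsStrictlyLE (-∑ i, p i) := by
  rw [CochainComplex.isStrictlyLE_iff]
  intro m hm
  change IsZero (free k (koszulDeg I p m))
  rw [koszulDeg_eq_empty hm]
  exact isZero_free_empty

/-- A bounded above complex of projectives is K-projective. -/
instance (I : Finset (Fin n)) (p : Fin n → ℤ) : (koszul k I p).IsKProjective :=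
  CochainComplex.isKProjective_of_projective _ (-∑ i, p i)

/-- The generator of degree p is reached only from p + ε_i in the box, hence with i ∈ I, and then
the coefficient z_i acts as zero. -/
theorem koszulD_comp_aug (I : Finset (Fin n)) (p : Fin n → ℤ) (s t : Finset (Fin n → ℤ))
    (hs : s ⊆ koszulBox I p) : koszulD k s t ≫ aug k t I p = 0 := by
  ext x
  rw [comp_apply, aug_apply, zero_apply]
  by_cases hp : p ∈ t
  · rw [coeff_koszulD hp, map_sum]
    refine Finset.sum_eq_zero fun i _ => ?_
    rw [Units.smul_def, map_zsmul]
    by_cases hi : i ∈ I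
    · rw [← smul_eq_mul, map_smul, X_smul_strSheaf_eq_zero hi, smul_zero]
    · rw [coeff_of_notMem, mul_zero, map_zero, smul_zero]
      intro h
      have := mem_koszulBox.1 (hs h) i
      rw [Pi.add_apply, Pi.single_eq_same] at this
      rcases this with h | ⟨h, -⟩
      · omega
      · exact hi h
  · rw [coeff_of_notMem hp, map_zero]

theorem koszulDeg_subset (I : Finset (Fin n)) (p : Fin n → ℤ) (m : ℤ) :
    koszulDeg I p m ⊆ koszulBox I p := Finset.filter_subset _ _

theorem coeff_eq_zero_of_lt {s : Finset (Fin n → ℤ)} {q e : Fin n → ℤ} {x : (free k s).carrier}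
    (hx : x ∈ (free k s).piece q) {i : Fin n} (hi : q i < e i) : coeff s e x = 0 :=
  eq_zero_of_mem_polyPiece (coeff_mem hx e) (sub_neg.2 hi)

/-- If q_i > p_i for some i ∈ I, the homotopy applies. Otherwise every generator e ≠ p has e_i = p_i
+ 1 > q_i for some i ∈ I, so outside the top degree the term has no elements of degree q. -/
theorem koszul_exactAt {I : Finset (Fin n)} {p : Fin n → ℤ} {m : ℤ} (hm : m ≠ -∑ i, p i) :
    (koszul k I p).ExactAt m := by
  rw [HomologicalComplex.exactAt_iff' _ (m - 1) m (m + 1) (by simp) (by simp)]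
  refine exact_of_forall_piece _ fun q x hx h0 => ?_
  change (free k (koszulDeg I p m)).carrier at x
  change ((koszul k I p).d m (m + 1)).toLin x = 0 at h0
  change ∃ y, ((koszul k I p).d (m - 1) m).toLin y = x
  rw [koszul_d rfl] at h0
  rw [koszul_d (sub_add_cancel m 1)]
  by_cases hq : ∃ i ∈ I, p i < q i
  · obtain ⟨i, hi, hlt⟩ := hq
    exact koszul_exact_of_lt hi hlt (sub_add_cancel m 1) rfl hx h0
  · push Not at hq
    refine ⟨0, (map_zero _).trans (free_ext fun e he => ?_)⟩
    have hbox := mem_koszulBox.1 (mem_koszulDeg.1 he).1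
    obtain ⟨i, hi⟩ : ∃ i, e i ≠ p i := by
      by_contra! h
      obtain rfl : e = p := funext h
      have := (mem_koszulDeg.1 he).2
      omega
    obtain ⟨hiI, hi⟩ := (hbox i).resolve_left hi
    have := hq i hiI
    exact (map_zero _).trans (coeff_eq_zero_of_lt hx (i := i) (by omega)).symm

theorem koszul_aug_exact {I : Finset (Fin n)} {p : Fin n → ℤ} {l m : ℤ} (hlm : l + 1 = m)
    (hm : m = -∑ i, p i) :
    (ShortComplex.mk (koszulD k (koszulDeg I p l) (koszulDeg I p m))
      (aug k (koszulDeg I p m) I p)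
      (koszulD_comp_aug I p _ _ (koszulDeg_subset I p l))).Exact := by
  refine exact_of_forall_piece _ fun q x hx h0 => ?_
  change (free k (koszulDeg I p m)).carrier at x
  change strMk I p (coeff (koszulDeg I p m) p x) = 0 at h0
  change ∃ y, (koszulD k (koszulDeg I p l) (koszulDeg I p m)).toLin y = x
  by_cases hq : ∃ i ∈ I, p i < q i
  · obtain ⟨i, hi, hlt⟩ := hq
    -- The next term is zero, so every element is a cocycle.
    refine koszul_exact_of_lt hi hlt hlm rfl hx (free_ext fun e he => ?_)
    rw [koszulDeg_eq_empty (by omega)] at he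
    exact absurd he (Finset.notMem_empty e)
  · push Not at hq
    refine ⟨0, (map_zero _).trans (free_ext fun e he => ?_)⟩
    subst hm
    obtain rfl := eq_of_mem_koszulDeg he
    rw [map_zero]
    by_contra h
    -- A monomial of degree q - p in the ideal would need a positive exponent q_i - p_i for some i ∈
    -- I, against q_i ≤ p_i.
    obtain ⟨d, hd⟩ := MvPolynomial.support_nonempty.2 (Ne.symm h)
    obtain ⟨i, hi, hdi⟩ := strMk_eq_zero.1 h0 d hd
    have h1 := mem_polyPiece.1 (coeff_mem hx e) d hd i
    have h2 := hq i hi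
    rw [Pi.sub_apply] at h1
    omega

theorem aug_surjective {s : Finset (Fin n → ℤ)} (I : Finset (Fin n)) {p : Fin n → ℤ}
    (hp : p ∈ s) : Function.Surjective (aug k s I p).toLin := by
  intro y
  obtain ⟨f, rfl⟩ := strMk_surjective I p y
  refine ⟨f • gen s p, ?_⟩
  rw [aug_apply, map_smul, coeff_gen_self hp, smul_eq_mul, mul_one]

/-- The augmentation of the Koszul complex. -/
def koszulAug (k : Type u) [Field k] {n : ℕ} (I : Finset (Fin n)) (p : Fin n → ℤ) :
    koszul k I p ⟶ (HomologicalComplex.single _ _ (-∑ i, p i)).obj (strSheaf k I p) :=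
  HomologicalComplex.mkHomToSingle (aug k (koszulDeg I p _) I p) fun l hl => by
    rw [koszul_d hl]
    exact koszulD_comp_aug I p _ _ (koszulDeg_subset I p l)

/-- Off degree -∑ p_i both complexes are exact. In that degree the outgoing differentials vanish,
and the claim is that `aug` is a cokernel of the incoming one. -/
instance (I : Finset (Fin n)) (p : Fin n → ℤ) : QuasiIso (koszulAug k I p) where
  quasiIsoAt m := by
    by_cases hm : m = -∑ i, p i
    · have hd : (koszul k I p).d m (m + 1) = 0 := by
        refine IsZero.eq_of_tgt ?_ _ _
        exact (koszul k I p).isZero_of_isStrictlyLE (-∑ i, p i) _ (by omega)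
      rw [quasiIsoAt_iff' _ (m - 1) m (m + 1) (by simp) (by simp),
        ShortComplex.quasiIso_iff_of_zeros' _ hd rfl rfl]
      subst hm
      have hf : (koszulAug k I p).f (-∑ i, p i) = aug k (koszulDeg I p _) I p ≫
        (HomologicalComplex.singleObjXSelf (.up ℤ) (-∑ i, p i) (strSheaf k I p)).inv :=
        HomologicalComplex.mkHomToSingle_f _ _
      have hepi : Epi (aug k (koszulDeg I p (-∑ i, p i)) I p) :=
        epi_of_surjective _ (aug_surjective I (self_mem_koszulDeg I p))
      constructor
      · refine ShortComplex.exact_of_iso ?_ (koszul_aug_exact (k := k) (I := I)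
          (sub_add_cancel (-∑ i, p i) 1) rfl)
        refine ShortComplex.isoMk (Iso.refl _) (Iso.refl _)
          (HomologicalComplex.singleObjXSelf (.up ℤ) (-∑ i, p i) (strSheaf k I p)).symm ?_ ?_
        · refine (Category.id_comp _).trans (Eq.trans ?_ (Category.comp_id _).symm)
          exact koszul_d (sub_add_cancel _ 1)
        · exact (Category.id_comp _).trans hf
      · change Epi ((koszulAug k I p).f _)
        rw [hf]
        exact epi_comp' hepi inferInstance
    · rw [quasiIsoAt_iff_exactAt _ _ (koszul_exactAt hm)]
      exact HomologicalComplex.exactAt_single_obj _ _ _ _ hm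

end EqCoh

noncomputable section

/-! ### Derived morphisms from a K-projective complex to a single complex -/

section KProjective

universe v w

variable {C : Type u} [Category.{v} C] [Abelian C]

open DerivedCategory

/-- The nonzero term of a single complex. -/
def singleXIso (j : ℤ) (F : C) : ((CochainComplex.singleFunctor C j).obj F).X j ≅ F :=
  HomologicalComplex.singleObjXSelf (.up ℤ) j F

/-- The morphism of complexes to a single complex that is attached to a cocycle. -/
def toSingle (K : CochainComplex C ℤ) {j : ℤ} {F : C} (φ : K.X j ⟶ F)
    (hφ : K.d (j - 1) j ≫ φ = 0) : K ⟶ (CochainComplex.singleFunctor C j).obj F :=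
  HomologicalComplex.mkHomToSingle (c := .up ℤ) φ fun i hi => by
    obtain rfl : i = j - 1 := eq_sub_of_add_eq hi
    exact hφ

theorem toSingle_f {K : CochainComplex C ℤ} {j : ℤ} {F : C} {φ : K.X j ⟶ F}
    (hφ : K.d (j - 1) j ≫ φ = 0) :
    (toSingle K φ hφ).f j = φ ≫ (singleXIso j F).inv :=
  HomologicalComplex.mkHomToSingle_f _ _

theorem toSingle_ext {K : CochainComplex C ℤ} {j : ℤ} {F : C}
    {f g : K ⟶ (CochainComplex.singleFunctor C j).obj F} (h : f.f j = g.f j) : f = g :=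
  HomologicalComplex.to_single_hom_ext h

theorem comp_toSingle {K L : CochainComplex C ℤ} (g : L ⟶ K) {j : ℤ} {F : C} {φ : K.X j ⟶ F}
    (hφ : K.d (j - 1) j ≫ φ = 0) :
    g ≫ toSingle K φ hφ = toSingle L (g.f j ≫ φ) (by rw [← g.comm_assoc, hφ, comp_zero]) := by
  refine toSingle_ext ?_
  rw [HomologicalComplex.comp_f, toSingle_f, toSingle_f, Category.assoc]

theorem smul_toSingle {R : Type*} [Ring R] [Linear R C] {K : CochainComplex C ℤ} {j : ℤ} {F : C}
    {φ : K.X j ⟶ F} (hφ : K.d (j - 1) j ≫ φ = 0) (c : R) :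
    c • toSingle K φ hφ = toSingle K (c • φ) (by rw [Linear.comp_smul, hφ, smul_zero]) := by
  refine toSingle_ext ?_
  rw [HomologicalComplex.smul_f_apply, toSingle_f, toSingle_f, Linear.smul_comp]

variable [HasDerivedCategory.{w} C]

/-- For K-projective K, homotopy classes of maps out of K are already the derived morphisms, and
every class has a representative. -/
theorem exists_Q_map_eq {K : CochainComplex C ℤ} [K.IsKProjective] {L : CochainComplex C ℤ}
    (f : Q.obj K ⟶ Q.obj L) : ∃ g : K ⟶ L, Q.map g = f := by
  obtain ⟨g, hg⟩ := (CochainComplex.IsKProjective.Qh_map_bijective K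
    ((HomotopyCategory.quotient _ _).obj L)).surjective
    ((quotientCompQhIso C).hom.app K ≫ f ≫ (quotientCompQhIso C).inv.app L)
  obtain ⟨g, rfl⟩ := (HomotopyCategory.quotient _ _).map_surjective g
  refine ⟨g, ?_⟩
  rw [← cancel_epi ((quotientCompQhIso C).hom.app K),
    ← quotientCompQhIso_hom_naturality, hg]
  simp

theorem nonempty_homotopy_of_Q_map_eq_zero {K : CochainComplex C ℤ} [K.IsKProjective]
    {L : CochainComplex C ℤ} {g : K ⟶ L} (h : Q.map g = 0) : Nonempty (Homotopy g 0) := by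
  have h1 : Qh.map ((HomotopyCategory.quotient C (.up ℤ)).map g) = 0 := by
    have := quotientCompQhIso_hom_naturality g
    rw [h, comp_zero] at this
    rwa [← cancel_mono ((quotientCompQhIso C).hom.app L), zero_comp]
  have h2 : (HomotopyCategory.quotient C (.up ℤ)).map g = 0 :=
    (CochainComplex.IsKProjective.Qh_map_bijective K _).injective
      (h1.trans (Functor.map_zero _ _ _).symm)
  exact ⟨HomotopyCategory.homotopyOfEq _ _ (h2.trans (Functor.map_zero _ _ _).symm)⟩

theorem Q_map_eq_zero_of_homotopy {K L : CochainComplex C ℤ} {g : K ⟶ L} (h : Homotopy g 0) :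
    Q.map g = 0 := by
  have h1 := HomotopyCategory.eq_of_homotopy _ _ h
  have := quotientCompQhIso_hom_naturality g
  rw [h1, Functor.map_zero, Functor.map_zero, zero_comp] at this
  rw [← cancel_epi ((quotientCompQhIso C).hom.app K), ← this, comp_zero]

/-- A chain map to a single complex is a cocycle. With `Q_map_toSingle_eq_zero` and
`exists_of_Q_map_toSingle_eq_zero`, derived morphisms become cocycles K^j → F modulo coboundaries.
-/
theorem exists_Q_map_toSingle_eq {K : CochainComplex C ℤ} [K.IsKProjective] {j : ℤ} {F : C}
    (f : Q.obj K ⟶ Q.obj ((CochainComplex.singleFunctor C j).obj F)) :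
    ∃ φ hφ, f = Q.map (toSingle K φ hφ) := by
  obtain ⟨g, rfl⟩ := exists_Q_map_eq f
  have h0 : ((CochainComplex.singleFunctor C j).obj F).d (j - 1) j = 0 := rfl
  refine ⟨g.f j ≫ (singleXIso j F).hom, ?_, ?_⟩
  · rw [← Category.assoc, ← g.comm, h0, comp_zero, zero_comp]
  · refine congrArg Q.map (toSingle_ext ?_)
    rw [toSingle_f, Category.assoc, Iso.hom_inv_id, Category.comp_id]

open CochainComplex.HomComplex in
theorem Q_map_toSingle_eq_zero {K : CochainComplex C ℤ} {j : ℤ} {F : C} {φ : K.X j ⟶ F}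
    (hφ : K.d (j - 1) j ≫ φ = 0) (ψ : K.X (j + 1) ⟶ F) (h : K.d j (j + 1) ≫ ψ = φ) :
    Q.map (toSingle K φ hφ) = 0 := by
  refine Q_map_eq_zero_of_homotopy ((Cochain.equivHomotopy _ _).symm
    ⟨Cochain.toSingleMk ψ (by omega), ?_⟩)
  rw [Cochain.δ_toSingleMk ψ (by omega) 0 j (by omega), h, Int.negOnePow_zero, one_smul,
    Cochain.ofHom_zero, add_zero]
  ext p
  rw [Cochain.ofHom_v]
  by_cases hp : p = j
  · subst hp
    rw [toSingle_f, Cochain.toSingleMk_v]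
    rfl
  · rw [Cochain.toSingleMk_v_eq_zero _ _ _ _ _ hp]
    exact IsZero.eq_of_tgt (HomologicalComplex.isZero_single_obj_X _ _ _ _ hp) _ _

theorem exists_of_Q_map_toSingle_eq_zero {K : CochainComplex C ℤ} [K.IsKProjective] {j : ℤ} {F : C}
    {φ : K.X j ⟶ F} {hφ : K.d (j - 1) j ≫ φ = 0} (h : Q.map (toSingle K φ hφ) = 0) :
    ∃ ψ : K.X (j + 1) ⟶ F, K.d j (j + 1) ≫ ψ = φ := by
  obtain ⟨H⟩ := nonempty_homotopy_of_Q_map_eq_zero h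
  refine ⟨H.hom (j + 1) j ≫ (singleXIso j F).hom, ?_⟩
  have := H.comm j
  have h0 : ((CochainComplex.singleFunctor C j).obj F).d (j - 1) j = 0 := rfl
  rw [dNext_eq H.hom (show (ComplexShape.up ℤ).Rel j (j + 1) from rfl),
    prevD_eq H.hom (show (ComplexShape.up ℤ).Rel (j - 1) j from sub_add_cancel j 1),
    toSingle_f, h0, comp_zero, add_zero, HomologicalComplex.zero_f, add_zero] at this
  rw [← Category.assoc, ← this, Category.assoc, Iso.inv_hom_id, Category.comp_id]

end KProjective

end

noncomputable section

namespace EqCoh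

variable {k : Type u} [Field k] {n : ℕ}

/-! ### Cocycles of the Koszul complex with values in `𝒪_{J,r}` -/

/-- Dual to `koszul_exact_of_lt`: all generators have e_i ≥ p_i ≥ r_i and i ∉ J, so z_i is bijective
between the pieces of 𝒪_{J,r} at the two ends of each edge in direction i, which contracts the
complex. -/
theorem koszul_cocycle_of_le {I J : Finset (Fin n)} {p r : Fin n → ℤ} {i : Fin n} (hi : i ∈ I)
    (hJ : i ∉ J) (hr : r i ≤ p i) {l m m' : ℤ} (hl : l + 1 = m) (hm : m + 1 = m')
    (φ : free k (koszulDeg I p m) ⟶ strSheaf k J r)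
    (hφ : koszulD k (koszulDeg I p l) (koszulDeg I p m) ≫ φ = 0) :
    ∃ ψ : free k (koszulDeg I p m') ⟶ strSheaf k J r,
      koszulD k (koszulDeg I p m) (koszulDeg I p m') ≫ ψ = φ := by
  have hdiv : ∀ e : Fin n → ℤ, ∃ z ∈ (strSheaf k J r).piece e, e i = p i →
      (MvPolynomial.X i : PolyRing k n) • z =
        koszulSign e i • φ.toLin (gen (koszulDeg I p m) (e + Pi.single i 1)) := by
    intro e
    by_cases he : e i = p i
    · have h1 : koszulSign e i • φ.toLin (gen (koszulDeg I p m) (e + Pi.single i 1)) ∈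
          (strSheaf k J r).piece (e + Pi.single i 1) := by
        rw [Units.smul_def]
        exact zsmul_mem (φ.map_mem _ _ (gen_mem _ _)) _
      obtain ⟨z, hz, hz'⟩ := exists_X_smul_strSheaf_eq h1 (by omega)
      exact ⟨z, hz, fun _ => hz'⟩
    · exact ⟨0, AddSubgroup.zero_mem _, fun h => absurd h he⟩
  choose z hzmem hz using hdiv
  -- Now the cochain lives on the face e_i = p_i. On a generator with e_i = p_i + 1 its coboundary
  -- sees only direction i and gives back φ.
  let ψ : free k (koszulDeg I p m') ⟶ strSheaf k J r :=
    freeHom (fun e => if e i = p i then z e else 0) fun e _ => by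
      split_ifs
      · exact hzmem e
      · exact AddSubgroup.zero_mem _
  have hψ0 : ∀ e : Fin n → ℤ, e i ≠ p i → ψ.toLin (gen (koszulDeg I p m') e) = 0 := by
    intro e he
    by_cases hmem : e ∈ koszulDeg I p m'
    · exact (freeHom_gen _ _ hmem).trans (if_neg he)
    · rw [gen_of_notMem hmem, map_zero]
  have hψ1 : ∀ e : Fin n → ℤ, e i = p i →
      (MvPolynomial.X i : PolyRing k n) • ψ.toLin (gen (koszulDeg I p m') e) =
        koszulSign e i • φ.toLin (gen (koszulDeg I p m) (e + Pi.single i 1)) := by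
    intro e he
    by_cases hmem : e ∈ koszulDeg I p m'
    · rw [← hz e he]
      exact congrArg _ ((freeHom_gen _ _ hmem).trans (if_pos he))
    · rw [gen_of_notMem hmem, gen_of_notMem fun h =>
        hmem ((add_single_mem_koszulDeg_iff hi he hm).1 h), map_zero, map_zero, smul_zero,
        smul_zero]
  have hlin : ∀ {Y : EqCoh k n} {s : Finset (Fin n → ℤ)} (θ : free k s ⟶ Y) (e : Fin n → ℤ)
      (w : Fin n → ℤ) (t : Fin n),
      θ.toLin (koszulSign e t • ((MvPolynomial.X t : PolyRing k n) • gen s w)) =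
        koszulSign e t • ((MvPolynomial.X t : PolyRing k n) • θ.toLin (gen s w)) := by
    intro Y s θ e w t
    rw [Units.smul_def, Units.smul_def, map_zsmul, map_smul]
  refine ⟨ψ, free_hom_ext fun e he => ?_⟩
  rw [comp_apply, koszulD_gen he, map_sum, Finset.sum_congr rfl fun t _ => hlin ψ e _ t]
  have hne : ∀ t, t ≠ i → (e - Pi.single t 1 : Fin n → ℤ) i = e i := fun t ht => by
    rw [Pi.sub_apply, Pi.single_eq_of_ne (Ne.symm ht), sub_zero]
  rcases mem_koszulBox.1 (mem_koszulDeg.1 he).1 i with hei | ⟨-, hei⟩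
  -- On the face e_i = p_i equality is tested after the injective multiplication by z_i, using the
  -- cocycle condition at e + ε_i.
  · refine sub_eq_zero.1 (X_smul_strSheaf_injective hJ ?_)
    have h1 := congrArg (fun θ => θ.toLin (gen (koszulDeg I p l) (e + Pi.single i 1))) hφ
    rw [comp_apply, koszulD_gen ((add_single_mem_koszulDeg_iff hi hei hl).2 he), map_sum,
      Finset.sum_congr rfl fun t _ => hlin φ _ _ t, zero_apply] at h1
    have hsum : ∀ t, (MvPolynomial.X i : PolyRing k n) • (koszulSign e t •
        ((MvPolynomial.X t : PolyRing k n) •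
          ψ.toLin (gen (koszulDeg I p m') (e - Pi.single t 1)))) =
        (if t = i then (MvPolynomial.X i : PolyRing k n) • φ.toLin (gen (koszulDeg I p m) e)
          else 0) - koszulSign e i • (koszulSign (e + Pi.single i 1) t •
            ((MvPolynomial.X t : PolyRing k n) •
              φ.toLin (gen (koszulDeg I p m) (e + Pi.single i 1 - Pi.single t 1)))) := by
      intro t
      split_ifs with ht
      · subst ht
        rw [hψ0, smul_zero, smul_zero, smul_zero, koszulSign_add_single_self, smul_smul,
          Int.units_mul_self, one_smul, add_sub_cancel_right, sub_self]
        rw [Pi.sub_apply, Pi.single_eq_same]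
        omega
      · have h3 := koszulSign_anticomm (e - Pi.single t 1) (Ne.symm ht)
        rw [sub_add_cancel, koszulSign_sub_single_self, ← add_sub_right_comm,
          koszulSign_sub_single_self] at h3
        have h4 : ∀ a b c d : ℤˣ, a * b = -(c * d) → b * d = -(a * c) := by decide
        rw [smul_comm (MvPolynomial.X i : PolyRing k n) (koszulSign e t),
          smul_comm (MvPolynomial.X i : PolyRing k n) (MvPolynomial.X t : PolyRing k n),
          hψ1 _ ((hne t ht).trans hei), smul_comm (MvPolynomial.X t : PolyRing k n), smul_smul,
          smul_smul, h4 _ _ _ _ h3, zero_sub, ← add_sub_right_comm, Units.smul_def,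
          Units.smul_def, Units.val_neg, neg_smul]
    rw [smul_sub, Finset.smul_sum, Finset.sum_congr rfl fun t _ => hsum t,
      Finset.sum_sub_distrib, Finset.sum_ite_eq' Finset.univ i, if_pos (Finset.mem_univ i),
      ← Finset.smul_sum, h1, smul_zero, sub_zero, sub_self]
  · rw [Finset.sum_eq_single i, hψ1, sub_add_cancel, smul_smul, koszulSign_sub_single_self,
      Int.units_mul_self, one_smul]
    · rw [Pi.sub_apply, Pi.single_eq_same]
      omega
    · intro t _ ht
      rw [hψ0, smul_zero, smul_zero]
      rw [hne t ht]
      omega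
    · exact fun h => absurd (Finset.mem_univ i) h

/-! ### Morphisms between the Koszul complexes -/

/-- The morphism of graded free modules that maps each generator of degree `e` to the generator of
degree `e` if there is one, and to zero otherwise. -/
def restr (k : Type u) [Field k] {n : ℕ} (s t : Finset (Fin n → ℤ)) : free k s ⟶ free k t where
  toLin :=
    { toFun x := ofCoeff t fun e => coeff s e x
      map_add' x y := funext fun e => map_add _ _ _
      map_smul' c x := funext fun e => map_smul _ _ _ }
  map_mem q x hx := mem_piece_free.2 fun e he => by
    have := coeff_ofCoeff he fun e => coeff s e x
    exact this ▸ coeff_mem hx e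

theorem coeff_restr {s t : Finset (Fin n → ℤ)} {e : Fin n → ℤ} (he : e ∈ t)
    (x : (free k s).carrier) : coeff t e ((restr k s t).toLin x) = coeff s e x :=
  coeff_ofCoeff he fun e => coeff s e x

theorem restr_comp_restr {s t r : Finset (Fin n → ℤ)} (h : ∀ e ∈ s, e ∈ r → e ∈ t) :
    restr k s t ≫ restr k t r = restr k s r := by
  ext x
  refine free_ext fun e he => ?_
  rw [comp_apply, coeff_restr he, coeff_restr he]
  by_cases ht : e ∈ t
  · rw [coeff_restr ht]
  · rw [coeff_of_notMem ht, coeff_of_notMem fun hs => ht (h e hs he)]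

/-- Signs and coefficients of the differential do not depend on the box, so commutation is only a
matter of which generators are present. -/
theorem restr_comp_koszulD {s s' t t' : Finset (Fin n → ℤ)}
    (h : ∀ e ∈ t', ∀ i, e + Pi.single i 1 ∈ s → (e + Pi.single i 1 ∈ t ↔ e ∈ s')) :
    restr k s t ≫ koszulD k t t' = koszulD k s s' ≫ restr k s' t' := by
  ext x
  refine free_ext fun e he => ?_
  rw [comp_apply, comp_apply, coeff_koszulD he, coeff_restr he]
  by_cases hs' : e ∈ s'
  · rw [coeff_koszulD hs']
    refine Finset.sum_congr rfl fun i _ => ?_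
    congr 2
    by_cases hs : e + Pi.single i 1 ∈ s
    · rw [coeff_restr ((h e he i hs).2 hs')]
    · rw [coeff_of_notMem hs]
      by_cases ht : e + Pi.single i 1 ∈ t
      · rw [coeff_restr ht, coeff_of_notMem hs]
      · rw [coeff_of_notMem ht]
  · rw [coeff_of_notMem hs']
    refine Finset.sum_eq_zero fun i _ => ?_
    by_cases ht : e + Pi.single i 1 ∈ t
    · rw [coeff_restr ht, coeff_of_notMem fun hs => hs' ((h e he i hs).1 ht), mul_zero, smul_zero]
    · rw [coeff_of_notMem ht, mul_zero, smul_zero]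

theorem restr_comp_aug {s t : Finset (Fin n → ℤ)} {I : Finset (Fin n)} {p : Fin n → ℤ}
    (hp : p ∈ t) : restr k s t ≫ aug k t I p = aug k s I p := by
  ext x
  rw [comp_apply, aug_apply, aug_apply, coeff_restr hp]

end EqCoh

/-! ### The combinatorics of the index sets -/

theorem mem_indexSet {n : ℕ} {a : Fin n → ℤ} {i : Fin n} : i ∈ indexSet a ↔ a i ≠ 0 := by
  rw [indexSet, Finset.mem_filter_univ]

theorem indexTwist_cases {n : ℕ} (a : Fin n → ℤ) (i : Fin n) :
    a i ≤ 0 ∧ indexTwist a i = a i ∨ 0 < a i ∧ indexTwist a i = a i - 1 := by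
  rw [indexTwist]
  split_ifs with h
  · exact Or.inl ⟨h, rfl⟩
  · exact Or.inr ⟨not_le.1 h, rfl⟩

theorem homCond_iff {n : ℕ} {a b : Fin n → ℤ} :
    HomCond a b ↔ ∀ i, b i = a i ∨ b i = a i + 1 ∨ b i = 1 ∧ a i = -1 := by
  refine forall_congr' fun i => ?_
  rw [Set.mem_insert_iff, Set.mem_singleton_iff, Prod.mk.injEq]
  omega

/-- The degrees of the generators of the Koszul resolution of `E_a`. -/
def excBox {n : ℕ} (a : Fin n → ℤ) : Finset (Fin n → ℤ) :=
  EqCoh.koszulBox (indexSet a) (indexTwist a)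

theorem mem_excBox {n : ℕ} {a e : Fin n → ℤ} :
    e ∈ excBox a ↔ ∀ i, a i = 0 ∧ e i = 0 ∨ a i < 0 ∧ (e i = a i ∨ e i = a i + 1) ∨
      0 < a i ∧ (e i = a i - 1 ∨ e i = a i) := by
  rw [excBox, EqCoh.mem_koszulBox]
  refine forall_congr' fun i => ?_
  rw [mem_indexSet]
  have := indexTwist_cases a i
  omega

/-- What makes `restr` a chain map. Only coordinate i matters: there the interval of b never starts
below that of a. The exceptional pair (1, -1) fits because {-1, 0} and {0, 1} are neighbours. -/
theorem HomCond.mem_iff {n : ℕ} {a b e : Fin n → ℤ} {i : Fin n} (h : HomCond a b)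
    (hb : e ∈ excBox b) (ha : e + Pi.single i 1 ∈ excBox a) :
    e + Pi.single i 1 ∈ excBox b ↔ e ∈ excBox a := by
  rw [homCond_iff] at h
  rw [mem_excBox] at ha hb ⊢
  rw [mem_excBox]
  constructor
  all_goals
    intro H j
    have h := h j
    have ha := ha j
    have hb := hb j
    have H := H j
    by_cases hj : j = i
    · subst hj
      rw [Pi.add_apply, Pi.single_eq_same] at *
      omega
    · rw [Pi.add_apply, Pi.single_eq_of_ne hj, add_zero] at *
      assumption

theorem HomCond.mem_of_mem {n : ℕ} {a b c e : Fin n → ℤ} (hab : HomCond a b) (hbc : HomCond b c)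
    (hac : HomCond a c) (ha : e ∈ excBox a) (hc : e ∈ excBox c) : e ∈ excBox b := by
  rw [homCond_iff] at hab hbc hac
  rw [mem_excBox] at ha hc ⊢
  intro i
  have h1 := hab i
  have h2 := hbc i
  have h3 := hac i
  have h4 := ha i
  have h5 := hc i
  omega

theorem HomCond.indexTwist_mem {n : ℕ} {a b : Fin n → ℤ} (h : HomCond a b) :
    indexTwist b ∈ excBox a := by
  rw [homCond_iff] at h
  rw [mem_excBox]
  intro i
  have h1 := h i
  have h2 := indexTwist_cases b i
  omega

/-- The second hypothesis excludes a_i = 1, b_i = 0, where 0 lies in {0, 1} although `HomCond`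
fails. -/
theorem homCond_of_mem {n : ℕ} {a b : Fin n → ℤ} (h : indexTwist b ∈ excBox a)
    (h0 : ∀ i, b i = 0 → a i ≤ 0) : HomCond a b := by
  rw [homCond_iff]
  rw [mem_excBox] at h
  intro i
  have h1 := h i
  have h2 := indexTwist_cases b i
  have h3 := h0 i
  omega

end

noncomputable section

variable {k : Type u} [Field k] {n : ℕ}

open EqCoh

/-! ### The Koszul resolutions of the exceptional objects -/

/-- The sheaf underlying `E_a`. -/
abbrev excSheaf (k : Type u) [Field k] {n : ℕ} (a : Fin n → ℤ) : EqCoh k n :=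
  strSheaf k (indexSet a) (indexTwist a)

/-- The Koszul complex of `E_a`. -/
abbrev excKoszul (k : Type u) [Field k] {n : ℕ} (a : Fin n → ℤ) : CochainComplex (EqCoh k n) ℤ :=
  koszul k (indexSet a) (indexTwist a)

/-- The degrees of the generators of the Koszul complex of `E_a` in cohomological degree `m`. -/
abbrev excDeg {n : ℕ} (a : Fin n → ℤ) (m : ℤ) : Finset (Fin n → ℤ) :=
  koszulDeg (indexSet a) (indexTwist a) m

theorem mem_excDeg {a e : Fin n → ℤ} {m : ℤ} :
    e ∈ excDeg a m ↔ e ∈ excBox a ∧ ∑ i, e i = -m := mem_koszulDeg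

theorem HomCond.indexTwist_mem_excDeg {a b : Fin n → ℤ} (h : HomCond a b) :
    indexTwist b ∈ excDeg a (-∑ i, indexTwist b i) :=
  mem_excDeg.2 ⟨h.indexTwist_mem, (neg_neg _).symm⟩

/-- The morphism between the Koszul complexes of `E_a` and `E_b`. -/
def excKoszulMap (k : Type u) [Field k] {n : ℕ} {a b : Fin n → ℤ} (h : HomCond a b) :
    excKoszul k a ⟶ excKoszul k b where
  f m := restr k (excDeg a m) (excDeg b m)
  comm' i j hij := by
    rw [koszul_d hij, koszul_d hij]
    refine restr_comp_koszulD fun e he t hs => ?_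
    have h1 := (mem_excDeg.1 hs).2
    have h2 := (mem_excDeg.1 he).2
    rw [mem_excDeg, mem_excDeg, h.mem_iff (mem_excDeg.1 he).1 (mem_excDeg.1 hs).1]
    exact and_congr_right fun _ => ⟨fun _ => h2, fun _ => h1⟩

theorem excKoszulMap_comp {a b c : Fin n → ℤ} (hab : HomCond a b) (hbc : HomCond b c)
    (hac : HomCond a c) :
    excKoszulMap k hab ≫ excKoszulMap k hbc = excKoszulMap k hac := by
  ext m : 1
  refine restr_comp_restr fun e ha hc => ?_
  rw [mem_excDeg] at ha hc ⊢
  exact ⟨hab.mem_of_mem hbc hac ha.1 hc.1, ha.2⟩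

/-- The vanishing of Hom(E_a, E_b[m]). If b_i = 0 < a_i for some i, direction i is contractible. If
not, a nonzero value of φ is possible only on the generator of degree p_b, which forces both m = 0
and `HomCond a b`. -/
theorem excKoszul_cocycle_eq_coboundary {a b : Fin n → ℤ} {m j : ℤ}
    (hj : ∑ i, indexTwist b i + m = -j) (h : m ≠ 0 ∨ ¬ HomCond a b)
    (φ : (excKoszul k a).X j ⟶ excSheaf k b) (hφ : (excKoszul k a).d (j - 1) j ≫ φ = 0) :
    ∃ ψ : (excKoszul k a).X (j + 1) ⟶ excSheaf k b, (excKoszul k a).d j (j + 1) ≫ ψ = φ := by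
  by_cases hA : ∃ i, b i = 0 ∧ 0 < a i
  · obtain ⟨i, hb, ha⟩ := hA
    rw [koszul_d (sub_add_cancel j 1)] at hφ
    rw [koszul_d rfl]
    refine koszul_cocycle_of_le (i := i) (mem_indexSet.2 ha.ne')
      (fun hi => mem_indexSet.1 hi hb) ?_ (sub_add_cancel j 1) rfl φ hφ
    have h1 := indexTwist_cases a i
    have h2 := indexTwist_cases b i
    omega
  · push Not at hA
    refine ⟨0, comp_zero.trans (free_hom_ext fun e he => ?_)⟩
    have hpiece := φ.map_mem e _ (gen_mem (excDeg a j) e)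
    obtain ⟨hbox, hsum⟩ := mem_excDeg.1 he
    by_contra hne
    have h1 : ∀ i, ¬ (e i < indexTwist b i ∨ i ∈ indexSet b ∧ e i ≠ indexTwist b i) :=
      fun i hi => hne (strSheaf_piece_eq_zero hpiece hi).symm
    obtain rfl : e = indexTwist b := funext fun i => by
      have h1 := h1 i
      have h2 := mem_excBox.1 hbox i
      have h3 := indexTwist_cases b i
      have h4 := hA i
      rw [mem_indexSet] at h1
      omega
    exact h.elim (fun h => h (by omega)) fun h => h (homCond_of_mem hbox hA)

/-- A generator of the same total degree as p_b but different from it lies below p_b in some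
coordinate, where the target vanishes. The piece of degree p_b is spanned by the class of 1. -/
theorem exists_eq_smul_aug (a b : Fin n → ℤ)
    (φ : free k (excDeg a (-∑ i, indexTwist b i)) ⟶ excSheaf k b) :
    ∃ c : k, φ = c • aug k _ _ _ := by
  obtain ⟨c, hc⟩ := exists_eq_C_smul_strOne (φ.map_mem _ _ (gen_mem _ (indexTwist b)))
  refine ⟨c, free_hom_ext fun e he => ?_⟩
  by_cases hne : e = indexTwist b
  · subst hne
    rw [hc, EqCoh.smul_apply, aug_apply, coeff_gen_self he]
    rfl
  · have hpiece : ∀ θ : free k (excDeg a (-∑ i, indexTwist b i)) ⟶ excSheaf k b,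
        θ.toLin (gen _ e) = 0 := fun θ => by
      obtain ⟨i, hi⟩ : ∃ i, e i < indexTwist b i := by
        by_contra! hle
        have h1 := (mem_excDeg.1 he).2
        rw [neg_neg] at h1
        exact hne (funext fun i => ((Finset.sum_eq_sum_iff_of_le fun i _ => hle i).1 h1.symm i
          (Finset.mem_univ i)).symm)
      exact strSheaf_piece_eq_zero (θ.map_mem _ _ (gen_mem _ e)) (Or.inl hi)
    rw [hpiece, hpiece]

/-- Generators one cohomological degree higher have smaller total degree than p_b, so there are no
nonzero cochains to take coboundaries of. -/
theorem aug_ne_coboundary {a b : Fin n → ℤ} (h : HomCond a b) {j : ℤ}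
    (hj : -∑ i, indexTwist b i + 1 = j) (d : free k (excDeg a (-∑ i, indexTwist b i)) ⟶
      free k (excDeg a j)) (ψ : free k (excDeg a j) ⟶ excSheaf k b) :
    d ≫ ψ ≠ aug k (excDeg a (-∑ i, indexTwist b i)) _ _ := by
  have hψ : ψ = 0 := free_hom_ext fun e he => by
    obtain ⟨i, hi⟩ : ∃ i, e i < indexTwist b i := by
      by_contra! hle
      have h1 := (mem_excDeg.1 he).2
      have h2 : ∑ i, indexTwist b i ≤ ∑ i, e i := Finset.sum_le_sum fun i _ => hle i
      omega
    exact strSheaf_piece_eq_zero (ψ.map_mem _ _ (gen_mem _ e)) (Or.inl hi)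
  rw [hψ, comp_zero]
  intro h0
  have h1 := congrArg (fun θ => θ.toLin (gen _ (indexTwist b))) h0
  refine strOne_ne_zero (k := k) (indexSet b) (indexTwist b) ?_
  refine Eq.trans ?_ h1.symm
  change _ = strMk _ _ (coeff _ _ _)
  rw [coeff_gen_self h.indexTwist_mem_excDeg]
  rfl

/-! ### Morphisms between the exceptional objects -/

open DerivedCategory

/-- The object of the derived category underlying `E_b[m]` is a single complex. -/
def excObjShiftIso (k : Type u) [Field k] {n : ℕ} (b : Fin n → ℤ) {m j : ℤ}
    (hj : ∑ i, indexTwist b i + m = -j) :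
    ((excObj k b)⟦m⟧).obj ≅
      Q.obj ((CochainComplex.singleFunctor (EqCoh k n) j).obj (excSheaf k b)) :=
  (((ObjectProperty.ι _).commShiftIso m).app (excObj k b)) ≪≫
    (shiftFunctor _ m).mapIso
      (((ObjectProperty.ι _).commShiftIso (∑ i, indexTwist b i)).app
        (DbCoh.ofSheaf (excSheaf k b)) ≪≫
      ((singleFunctors (EqCoh k n)).shiftIso (∑ i, indexTwist b i) (-∑ i, indexTwist b i) 0
        (by omega)).app (excSheaf k b)) ≪≫
    ((singleFunctors (EqCoh k n)).shiftIso m j (-∑ i, indexTwist b i)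
        (by omega)).app (excSheaf k b)

/-- The object of the derived category underlying `E_b` is a single complex. -/
def excObjIso (k : Type u) [Field k] {n : ℕ} (b : Fin n → ℤ) :
    (excObj k b).obj ≅ Q.obj ((CochainComplex.singleFunctor (EqCoh k n)
      (-∑ i, indexTwist b i)).obj (excSheaf k b)) :=
  ((ObjectProperty.ι _).commShiftIso (∑ i, indexTwist b i)).app
        (DbCoh.ofSheaf (excSheaf k b)) ≪≫
      ((singleFunctors (EqCoh k n)).shiftIso (∑ i, indexTwist b i) (-∑ i, indexTwist b i) 0
        (by omega)).app (excSheaf k b)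

theorem excKoszul_d_comp_aug (a : Fin n → ℤ) :
    (excKoszul k a).d (-∑ i, indexTwist a i - 1) (-∑ i, indexTwist a i) ≫
      aug k (excDeg a (-∑ i, indexTwist a i)) (indexSet a) (indexTwist a) = 0 := by
  rw [koszul_d (sub_add_cancel _ 1)]
  exact koszulD_comp_aug _ _ _ _ (koszulDeg_subset _ _ _)

/-- The augmentation of the Koszul complex of `E_a`. -/
def excAug (k : Type u) [Field k] {n : ℕ} (a : Fin n → ℤ) : excKoszul k a ⟶
    (CochainComplex.singleFunctor (EqCoh k n) (-∑ i, indexTwist a i)).obj (excSheaf k a) :=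
  toSingle (excKoszul k a) (aug k (excDeg a (-∑ i, indexTwist a i)) (indexSet a) (indexTwist a))
    (excKoszul_d_comp_aug a)

instance (a : Fin n → ℤ) : QuasiIso (excAug k a) :=
  inferInstanceAs (QuasiIso (koszulAug k (indexSet a) (indexTwist a)))

/-- The Koszul complex of `E_a` represents `E_a`. -/
def excKoszulIso (k : Type u) [Field k] {n : ℕ} (a : Fin n → ℤ) :
    Q.obj (excKoszul k a) ≅ (excObj k a).obj :=
  asIso (Q.map (excAug k a)) ≪≫ (excObjIso k a).symm

theorem excObj_hom_shift_eq_zero {a b : Fin n → ℤ} {m : ℤ} (h : m ≠ 0 ∨ ¬ HomCond a b)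
    (f : excObj k a ⟶ (excObj k b)⟦m⟧) : f = 0 := by
  have hj : ∑ i, indexTwist b i + m = - -(∑ i, indexTwist b i + m) := (neg_neg _).symm
  obtain ⟨φ, hφ, hf⟩ := exists_Q_map_toSingle_eq
    ((excKoszulIso k a).hom ≫ f.hom ≫ (excObjShiftIso k b hj).hom)
  obtain ⟨ψ, hψ⟩ := excKoszul_cocycle_eq_coboundary hj h φ hφ
  rw [Q_map_toSingle_eq_zero hφ ψ hψ] at hf
  refine ObjectProperty.hom_ext _ ?_
  rw [← cancel_epi (excKoszulIso k a).hom, ← cancel_mono (excObjShiftIso k b hj).hom,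
    Category.assoc, hf]
  simp

theorem excObj_hom_eq_zero {a b : Fin n → ℤ} (h : ¬ HomCond a b)
    (f : excObj k a ⟶ excObj k b) : f = 0 := by
  rw [← cancel_mono ((shiftFunctorZero (DbCoh k n) ℤ).inv.app (excObj k b)), zero_comp]
  exact excObj_hom_shift_eq_zero (Or.inr h) _

open Classical in
/-- The generator of the space of morphisms from `E_a` to `E_b`. -/
def excGen (k : Type u) [Field k] {n : ℕ} (a b : Fin n → ℤ) : excObj k a ⟶ excObj k b :=
  if h : HomCond a b then
    ObjectProperty.homMk ((excKoszulIso k a).inv ≫ Q.map (excKoszulMap k h) ≫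
      (excKoszulIso k b).hom)
  else 0

theorem excGen_hom {a b : Fin n → ℤ} (h : HomCond a b) :
    (excGen k a b).hom = (excKoszulIso k a).inv ≫ Q.map (excKoszulMap k h) ≫
      (excKoszulIso k b).hom := by
  rw [excGen, dif_pos h]
  rfl

theorem excGen_comp {a b c : Fin n → ℤ} (hab : HomCond a b) (hbc : HomCond b c)
    (hac : HomCond a c) : excGen k a b ≫ excGen k b c = excGen k a c := by
  refine ObjectProperty.hom_ext _ ?_
  rw [ObjectProperty.FullSubcategory.comp_hom, excGen_hom hab, excGen_hom hbc, excGen_hom hac,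
    ← excKoszulMap_comp hab hbc hac, Functor.map_comp]
  simp only [Category.assoc, Iso.hom_inv_id_assoc]

/-- As a cocycle the generator is the coefficient at p_b, because `restr` preserves that
coefficient. This links it to the computation of Hom(E_a, E_b). -/
theorem excKoszulIso_hom_comp_excGen_hom {a b : Fin n → ℤ} (h : HomCond a b) :
    ∃ hφ, (excKoszulIso k a).hom ≫ (excGen k a b).hom ≫ (excObjIso k b).hom =
      Q.map (toSingle (excKoszul k a)
        (aug k (excDeg a (-∑ i, indexTwist b i)) (indexSet b) (indexTwist b)) hφ) := by
  have h1 : restr k (excDeg a (-∑ i, indexTwist b i)) (excDeg b (-∑ i, indexTwist b i)) ≫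
      aug k _ (indexSet b) (indexTwist b) = aug k _ (indexSet b) (indexTwist b) :=
    restr_comp_aug (self_mem_koszulDeg _ _)
  have h2 := comp_toSingle (excKoszulMap k h) (excKoszul_d_comp_aug (k := k) b)
  have h3 : (excKoszulIso k a).hom ≫ (excGen k a b).hom ≫ (excObjIso k b).hom =
      Q.map (excKoszulMap k h ≫ excAug k b) := by
    rw [excGen_hom h, Functor.map_comp, excKoszulIso, excKoszulIso]
    simp
  -- Replaces the cocycle by an equal one together with the proof that depends on it.
  have key : ∀ φ (hφ : (excKoszul k a).d (-∑ i, indexTwist b i - 1) (-∑ i, indexTwist b i) ≫ φ = 0)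
      φ', φ = φ' → excKoszulMap k h ≫ excAug k b = toSingle (excKoszul k a) φ hφ →
      ∃ hφ', excKoszulMap k h ≫ excAug k b = toSingle (excKoszul k a) φ' hφ' := by
    rintro φ hφ _ rfl h
    exact ⟨hφ, h⟩
  obtain ⟨hφ, h4⟩ := key _ _ _ h1 h2
  exact ⟨hφ, h3.trans (congrArg _ h4)⟩

theorem excGen_ne_zero {a b : Fin n → ℤ} (h : HomCond a b) : excGen k a b ≠ 0 := by
  intro h0
  obtain ⟨hφ, h1⟩ := excKoszulIso_hom_comp_excGen_hom (k := k) h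
  rw [h0] at h1
  have h2 : (0 : excObj k a ⟶ excObj k b).hom = 0 := rfl
  rw [h2, zero_comp, comp_zero] at h1
  obtain ⟨ψ, hψ⟩ := exists_of_Q_map_toSingle_eq_zero h1.symm
  exact aug_ne_coboundary h rfl _ ψ hψ

theorem exists_eq_smul_excGen {a b : Fin n → ℤ} (h : HomCond a b) (f : excObj k a ⟶ excObj k b) :
    ∃ c : k, c • excGen k a b = f := by
  obtain ⟨hφ, h1⟩ := excKoszulIso_hom_comp_excGen_hom (k := k) h
  obtain ⟨φ, hφ', h2⟩ := exists_Q_map_toSingle_eq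
    ((excKoszulIso k a).hom ≫ f.hom ≫ (excObjIso k b).hom)
  obtain ⟨c, rfl⟩ := exists_eq_smul_aug a b φ
  refine ⟨c, ObjectProperty.hom_ext _ ?_⟩
  rw [← cancel_epi (excKoszulIso k a).hom, ← cancel_mono (excObjIso k b).hom, Category.assoc,
    Category.assoc, h2]
  have h3 : (c • excGen k a b).hom = c • (excGen k a b).hom := rfl
  rw [h3, Linear.smul_comp, Linear.comp_smul, h1, ← Functor.map_smul]
  exact congrArg _ (smul_toSingle hφ c)

theorem finrank_excObj_hom {a b : Fin n → ℤ} (h : HomCond a b) :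
    Module.finrank k (excObj k a ⟶ excObj k b) = 1 :=
  (finrank_eq_one_iff_of_nonzero' _ (excGen_ne_zero h)).2 (exists_eq_smul_excGen h)

theorem nontrivial_excObj_hom_iff {a b : Fin n → ℤ} :
    Nontrivial (excObj k a ⟶ excObj k b) ↔ HomCond a b := by
  refine ⟨fun _ => ?_, fun h => ⟨_, _, excGen_ne_zero h⟩⟩
  by_contra h
  obtain ⟨f, hf⟩ := exists_ne (0 : excObj k a ⟶ excObj k b)
  exact hf (excObj_hom_eq_zero h f)

/-! ### Order and parametrization of the index set -/

theorem homCond_refl (a : Fin n → ℤ) : HomCond a a :=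
  homCond_iff.2 fun _ => Or.inl rfl

theorem HomCond.toLex_le {a b : Fin n → ℤ} (h : HomCond a b) : toLex a ≤ toLex b :=
  Pi.toLex_monotone fun i => by
    rcases homCond_iff.1 h i with h | h | h <;> omega

theorem bijOn_indexSet_indexTwist (n : ℕ) :
    Set.BijOn (fun a : Fin n → ℤ => (indexSet a, indexTwist a)) Set.univ
      {x : Finset (Fin n) × (Fin n → ℤ) | ∀ i, x.2 i ≠ 0 → i ∈ x.1} := by
  refine ⟨fun a _ i h => ?_, fun a _ b _ h => funext fun i => ?_, fun x hx => ?_⟩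
  · have := indexTwist_cases a i
    exact mem_indexSet.2 fun h0 => h (by dsimp only; omega)
  · obtain ⟨h1, h2⟩ := Prod.ext_iff.1 h
    have h3 : i ∈ indexSet a ↔ i ∈ indexSet b := by
      dsimp only at h1
      rw [h1]
    have h4 := congrFun h2 i
    dsimp only at h4
    rw [mem_indexSet, mem_indexSet] at h3
    have := indexTwist_cases a i
    have := indexTwist_cases b i
    omega
  · classical
    -- Both a_i = 0 and a_i = 1 have p_i = 0; membership in I tells them apart.
    let a : Fin n → ℤ := fun i => if i ∈ x.1 then if x.2 i < 0 then x.2 i else x.2 i + 1 else 0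
    have ha : ∀ i, i ∈ x.1 ∧ (x.2 i < 0 ∧ a i = x.2 i ∨ 0 ≤ x.2 i ∧ a i = x.2 i + 1) ∨
        i ∉ x.1 ∧ a i = 0 := fun i => by
      dsimp only [a]
      split_ifs with h1 h2
      · exact Or.inl ⟨h1, Or.inl ⟨h2, rfl⟩⟩
      · exact Or.inl ⟨h1, Or.inr ⟨not_lt.1 h2, rfl⟩⟩
      · exact Or.inr ⟨h1, rfl⟩
    refine ⟨a, Set.mem_univ _, Prod.ext (Finset.ext fun i => ?_) (funext fun i => ?_)⟩
    · rw [mem_indexSet]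
      have := ha i
      by_cases h : i ∈ x.1
      · simp only [h, true_and, not_true_eq_false, false_and, or_false, iff_true] at this ⊢
        omega
      · simp only [h, false_and, not_false_eq_true, true_and, false_or] at this ⊢
        simpa using this
    · have h1 := ha i
      have h2 := indexTwist_cases a i
      have h3 := hx i
      dsimp only
      by_cases h : i ∈ x.1
      · simp only [h, true_and, not_true_eq_false, false_and, or_false] at h1
        omega
      · have h4 : x.2 i = 0 := not_not.1 fun h' => h (h3 h')
        simp only [h, false_and, not_false_eq_true, true_and, false_or] at h1
        omega

end

noncomputable section

variable {k : Type u} [Field k] {n : ℕ}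

/-! ### Generation of the bounded derived category by the single complexes -/

section Bounded

universe v w

variable {C : Type u} [Category.{v} C] [Abelian C] [HasDerivedCategory.{w} C]

open DerivedCategory

/-- Induction on the cohomological amplitude: the truncation triangle at a + 1 splits off the lowest
cohomology, and amplitude zero is a shifted sheaf. -/
theorem prop_of_isGE_of_isLE (R : ObjectProperty (DerivedCategory C)) [R.IsTriangulated]
    [R.IsClosedUnderIsomorphisms] (h : ∀ F : C, R ((singleFunctor C 0).obj F)) (d : ℕ) :
    ∀ (a b : ℤ) (X : DerivedCategory C), a + d = b → X.IsGE a → X.IsLE b → R X := by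
  induction d with
  | zero =>
    intro a b X hab _ _
    obtain rfl : a = b := by omega
    obtain ⟨F, ⟨e⟩⟩ := exists_iso_singleFunctor_obj_of_isGE_of_isLE X a
    refine R.prop_of_iso e.symm ?_
    rw [← R.prop_shift_iff_of_isStableUnderShift _ a]
    exact R.prop_of_iso (((singleFunctors C).shiftIso a 0 a (by omega)).symm.app F) (h F)
  | succ d ih =>
    intro a b X hab _ _
    refine R.ext_of_isTriangulatedClosed₂ _
      (TStructure.t.triangleLTGE_distinguished (a + 1) X) ?_ ?_
    · refine ih a (a + d) _ rfl ?_ ?_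
      · exact inferInstanceAs (TStructure.t.IsGE ((TStructure.t.truncLT (a + 1)).obj X) a)
      · exact TStructure.t.isLE_truncLT_obj X (a + 1) (a + d) (by omega)
    · refine ih (a + 1) b _ (by omega) ?_ ?_
      · exact inferInstanceAs (TStructure.t.IsGE ((TStructure.t.truncGE (a + 1)).obj X) (a + 1))
      · exact inferInstanceAs (TStructure.t.IsLE ((TStructure.t.truncGE (a + 1)).obj X) b)

theorem prop_of_bounded (R : ObjectProperty (DerivedCategory C)) [R.IsTriangulated]
    [R.IsClosedUnderIsomorphisms] (h : ∀ F : C, R ((singleFunctor C 0).obj F))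
    {X : DerivedCategory C} (hX : TStructure.t.bounded X) : R X := by
  obtain ⟨⟨a, ha⟩, ⟨b, hb⟩⟩ := hX
  -- The bounds may satisfy b < a; the maximum covers this case.
  refine prop_of_isGE_of_isLE R h (b - a).toNat a (max a b) X ?_ ha
    (TStructure.t.isLE_of_le X b (max a b) (le_max_right _ _))
  omega

end Bounded

namespace EqCoh

/-! ### Morphisms from `𝒪_{I,p}` -/

/-- The morphism from `𝒪_{I,p}` given by a homogeneous element that is killed by `z_i`, `i ∈ I`. -/
def strDesc {N : EqCoh k n} {I : Finset (Fin n)} {p : Fin n → ℤ} (x : N.carrier)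
    (hx : x ∈ N.piece p) (hI : ∀ i ∈ I, (MvPolynomial.X i : PolyRing k n) • x = 0) :
    strSheaf k I p ⟶ N where
  toLin := Submodule.liftQ (Ideal.span (MvPolynomial.X '' (I : Set (Fin n))) :
      Ideal (PolyRing k n)) (LinearMap.toSpanSingleton (PolyRing k n) N.carrier x) (by
    refine Submodule.span_le.2 ?_
    rintro _ ⟨i, hi, rfl⟩
    exact hI i hi)
  map_mem q y hy := by
    obtain ⟨f, hf, rfl⟩ := mem_piece_strSheaf.1 hy
    have := N.smul_mem (q - p) p f x hf hx
    rwa [sub_add_cancel] at this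

theorem strDesc_strMk {N : EqCoh k n} {I : Finset (Fin n)} {p : Fin n → ℤ} {x : N.carrier}
    (hx : x ∈ N.piece p) (hI : ∀ i ∈ I, (MvPolynomial.X i : PolyRing k n) • x = 0)
    (f : PolyRing k n) : (strDesc x hx hI).toLin (strMk I p f) = f • x := rfl

theorem injective_of_forall_piece {M N : EqCoh k n} (φ : M ⟶ N)
    (h : ∀ q, ∀ x ∈ M.piece q, φ.toLin x = 0 → x = 0) : Function.Injective φ.toLin := by
  rw [← LinearMap.ker_eq_bot, eq_bot_iff]
  intro x hx
  obtain ⟨s, hs⟩ := M.proj_sum x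
  rw [Submodule.mem_bot, hs]
  refine Finset.sum_eq_zero fun q _ => h q _ (M.proj_mem q x) ?_
  rw [toLin_proj, LinearMap.mem_ker.1 hx, map_zero]

/-- Among nonzero homogeneous elements take one killed by a maximal set I of variables. No monomial
in the other variables kills it, so it generates a twist of 𝒪_I: the graded form of an associated
prime. -/
theorem exists_injective_strSheaf (N : EqCoh k n) {x : N.carrier} (hx : x ≠ 0) :
    ∃ (I : Finset (Fin n)) (p : Fin n → ℤ) (φ : strSheaf k I p ⟶ N),
      Function.Injective φ.toLin := by
  let good (I : Finset (Fin n)) (x : N.carrier) : Prop := (∃ p, x ∈ N.piece p) ∧ x ≠ 0 ∧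
    ∀ i ∈ I, (MvPolynomial.X i : PolyRing k n) • x = 0
  have hS : {I | ∃ x, good I x}.Nonempty := by
    obtain ⟨s, hs⟩ := N.proj_sum x
    obtain ⟨q, hq⟩ : ∃ q, N.proj q x ≠ 0 := by
      by_contra! h
      exact hx (hs.trans (Finset.sum_eq_zero fun q _ => h q))
    exact ⟨∅, N.proj q x, ⟨q, N.proj_mem q x⟩, hq, fun i hi => absurd hi (Finset.notMem_empty i)⟩
  obtain ⟨I, ⟨x, hgood⟩, hmax⟩ := wellFounded_gt.has_min _ hS
  -- By maximality of I, each z_i with i ∉ I maps good elements to good elements; being a submonoid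
  -- extends this to monomials.
  let T : Submonoid (PolyRing k n) :=
    { carrier := {g | ∀ y, good I y → good I (g • y)}
      one_mem' := fun y hy => by rwa [one_smul]
      mul_mem' := fun {f g} hf hg y hy => by
        rw [mul_smul]
        exact hf _ (hg _ hy) }
  have hT : ∀ i, i ∉ I → (MvPolynomial.X i : PolyRing k n) ∈ T := by
    rintro i hi y ⟨⟨q, hy⟩, hy0, hyI⟩
    refine ⟨⟨_, N.smul_mem _ q _ y (X_mem_polyPiece i) hy⟩, fun h => ?_, fun j hj => ?_⟩
    · refine hmax (insert i I) ⟨y, ⟨q, hy⟩, hy0, fun j hj => ?_⟩ (Finset.ssubset_insert hi)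
      rcases Finset.mem_insert.1 hj with rfl | hj
      exacts [h, hyI j hj]
    · rw [smul_comm, hyI j hj, smul_zero]
  have hmon : ∀ d : Fin n →₀ ℕ, (∀ i ∈ I, d i = 0) →
      (MvPolynomial.monomial d (1 : k)) • x ≠ 0 := by
    intro d hd
    have h : MvPolynomial.monomial d (1 : k) ∈ T := by
      rw [MvPolynomial.monomial_eq, map_one, one_mul]
      exact Submonoid.prod_mem _ fun i hi => Submonoid.pow_mem _
        (hT i fun hiI => Finsupp.mem_support_iff.1 hi (hd i hiI)) _
    exact (h x hgood).2.1
  obtain ⟨⟨p, hx⟩, h0, hI⟩ := hgood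
  refine ⟨I, p, strDesc x hx hI, injective_of_forall_piece _ fun q y hy hy0 => ?_⟩
  obtain ⟨f, hf, rfl⟩ := mem_piece_strSheaf.1 hy
  rw [strDesc_strMk] at hy0
  by_cases hf0 : f = 0
  · rw [hf0, map_zero]
  obtain ⟨d, c, -, rfl⟩ := exists_eq_monomial hf hf0
  have hc : c ≠ 0 := fun hc => hf0 (by rw [hc, map_zero])
  by_contra hne
  refine hmon d (fun i hi => ?_) ?_
  · by_contra hd
    refine hne (strMk_eq_zero.2 fun m hm => ⟨i, hi, ?_⟩)
    rwa [Finset.mem_singleton.1 (MvPolynomial.support_monomial_subset hm)]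
  · have h1 : MvPolynomial.monomial d (1 : k) =
        MvPolynomial.C c⁻¹ * MvPolynomial.monomial d c := by
      rw [MvPolynomial.C_mul_monomial, inv_mul_cancel₀ hc]
    rw [h1, mul_smul, hy0, smul_zero]

/-! ### Generation of the category of equivariant sheaves -/

/-- The extension of `𝒪_{I ∪ i,p}` by multiplication with `z_i`. -/
def mulXShortComplex (k : Type u) [Field k] {n : ℕ} (I : Finset (Fin n))
    (p : Fin n → ℤ) (i : Fin n) : ShortComplex (EqCoh k n) where
  X₁ := strSheaf k I (p + Pi.single i 1)
  X₂ := strSheaf k I p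
  X₃ := strSheaf k (insert i I) p
  f := strDesc ((MvPolynomial.X i : PolyRing k n) • strOne k I p)
    (by
      rw [add_comm]
      exact smul_mem _ _ _ _ _ (X_mem_polyPiece i) (strOne_mem I p))
    (fun j hj => X_smul_strSheaf_eq_zero hj _)
  g := strDesc (strOne k _ p) (strOne_mem _ p)
    (fun j hj => X_smul_strSheaf_eq_zero (Finset.mem_insert_of_mem hj) _)
  zero := by
    ext y
    obtain ⟨f, rfl⟩ := strMk_surjective _ _ y
    rw [comp_apply, strDesc_strMk, map_smul, map_smul, X_smul_strSheaf_eq_zero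
      (Finset.mem_insert_self i I), smul_zero]
    rfl

theorem mulXShortComplex_shortExact {I : Finset (Fin n)} (p : Fin n → ℤ) {i : Fin n} (hi : i ∉ I) :
    (mulXShortComplex k I p i).ShortExact where
  exact := by
    refine exact_of_forall_piece _ fun q y hy h0 => ?_
    obtain ⟨f, hf, rfl⟩ := mem_piece_strSheaf.1 hy
    have hmul : ∀ g : PolyRing k n, (mulXShortComplex k I p i).f.toLin (strMk I _ g) =
        strMk I p (MvPolynomial.X i * g) := fun g => by
      change g • (MvPolynomial.X i : PolyRing k n) • strMk (k := k) I p 1 = _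
      rw [← map_smul, ← map_smul, smul_eq_mul, smul_eq_mul, mul_one, mul_comm]
    have h1 : strMk (insert i I) p f = 0 := by
      refine Eq.trans ?_ h0
      change _ = f • strMk (k := k) (insert i I) p 1
      rw [← map_smul, smul_eq_mul, mul_one]
    by_cases hf0 : f = 0
    · exact ⟨0, by rw [hf0, map_zero, map_zero]; rfl⟩
    obtain ⟨d, c, -, rfl⟩ := exists_eq_monomial hf hf0
    have hc : c ≠ 0 := fun hc => hf0 (by rw [hc, map_zero])
    obtain ⟨j, hj, hdj⟩ := strMk_eq_zero.1 h1 d (by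
      rw [MvPolynomial.mem_support_iff, MvPolynomial.coeff_monomial, if_pos rfl]
      exact hc)
    rcases Finset.mem_insert.1 hj with rfl | hj
    · refine ⟨strMk I _ (MvPolynomial.monomial (d - Finsupp.single j 1) c), ?_⟩
      rw [hmul, MvPolynomial.X, MvPolynomial.monomial_mul, one_mul,
        add_tsub_cancel_of_le (Finsupp.single_le_iff.2 (Nat.one_le_iff_ne_zero.2 hdj))]
    · refine ⟨0, (map_zero _).trans (Eq.symm (strMk_eq_zero.2 fun m hm => ⟨j, hj, ?_⟩))⟩
      rwa [Finset.mem_singleton.1 (MvPolynomial.support_monomial_subset hm)]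
  mono_f := by
    refine mono_of_injective _ ?_
    rw [← LinearMap.ker_eq_bot, eq_bot_iff]
    intro y hy
    obtain ⟨f, rfl⟩ := strMk_surjective _ _ y
    have h1 : f • (MvPolynomial.X i : PolyRing k n) • strMk (k := k) I p 1 = 0 :=
      LinearMap.mem_ker.1 hy
    rw [smul_comm] at h1
    have h2 := X_smul_strSheaf_injective hi h1
    rw [← map_smul, smul_eq_mul, mul_one] at h2
    exact h2
  epi_g := epi_of_surjective _ fun y => by
    obtain ⟨f, rfl⟩ := strMk_surjective _ _ y
    refine ⟨strMk I p f, ?_⟩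
    change f • strMk (k := k) (insert i I) p 1 = _
    rw [← map_smul, smul_eq_mul, mul_one]

/-- Induction on the number of variables outside I. The quotient of 𝒪_{I,p} by the image of z_i is
covered by induction, so p_i may be changed freely for i ∉ I and hence made zero. -/
theorem prop_strSheaf {R : ObjectProperty (EqCoh k n)}
    (h₁ : ∀ S : ShortComplex (EqCoh k n), S.ShortExact → R S.X₂ → R S.X₃ → R S.X₁)
    (h₂ : ∀ S : ShortComplex (EqCoh k n), S.ShortExact → R S.X₁ → R S.X₃ → R S.X₂)
    (h : ∀ (I : Finset (Fin n)) (p : Fin n → ℤ), (∀ i, p i ≠ 0 → i ∈ I) → R (strSheaf k I p))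
    (I : Finset (Fin n)) (p : Fin n → ℤ) : R (strSheaf k I p) := by
  induction hm : Iᶜ.card using Nat.strong_induction_on generalizing I p with
  | h m ih =>
    have hins : ∀ i, i ∉ I → ∀ p, R (strSheaf k (insert i I) p) := fun i hi p =>
      ih _ (by
        rw [← hm]
        exact Finset.card_lt_card (Finset.compl_ssubset_compl.2 (Finset.ssubset_insert hi))) _ p rfl
    have hiff : ∀ i, i ∉ I → ∀ p, R (strSheaf k I (p + Pi.single i 1)) ↔ R (strSheaf k I p) :=
      fun i hi p => ⟨fun hp => h₂ _ (mulXShortComplex_shortExact p hi) hp (hins i hi p),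
        fun hp => h₁ _ (mulXShortComplex_shortExact p hi) hp (hins i hi p)⟩
    have hmove : ∀ i, i ∉ I → ∀ (c : ℤ) p,
        R (strSheaf k I (p + Pi.single i c)) ↔ R (strSheaf k I p) := fun i hi c p => by
      induction c with
      | zero => rw [Pi.single_zero, add_zero]
      | succ c hc => rw [Pi.single_add, ← add_assoc, hiff i hi, hc]
      | pred c hc =>
        rw [← hc, ← hiff i hi, add_assoc, ← Pi.single_add, sub_add_cancel]
    -- The coordinates outside I are cleared one at a time; s bounds those still to be cleared.
    have key : ∀ (s : Finset (Fin n)) (p : Fin n → ℤ), (∀ i, p i ≠ 0 → i ∈ I ∨ i ∈ s) →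
        R (strSheaf k I p) := fun s => by
      induction s using Finset.induction with
      | empty => exact fun p hp => h I p fun i hi =>
          (hp i hi).resolve_right (Finset.notMem_empty i)
      | insert j s _ hs =>
        intro p hp
        by_cases hj : j ∈ I
        · refine hs p fun i hi => ?_
          by_cases hij : i = j
          · exact Or.inl (hij ▸ hj)
          · exact (hp i hi).imp_right fun h => Finset.mem_of_mem_insert_of_ne h hij
        · rw [← hmove j hj (-p j)]
          refine hs _ fun i hi => ?_
          rw [Pi.add_apply] at hi
          by_cases hij : i = j
          · subst hij
            rw [Pi.single_eq_same, add_neg_cancel] at hi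
            exact absurd rfl hi
          · rw [Pi.single_eq_of_ne hij, add_zero] at hi
            exact (hp i hi).imp_right fun h => Finset.mem_of_mem_insert_of_ne h hij
    exact key Finset.univ p fun i _ => Or.inr (Finset.mem_univ i)

/-- The next filtration step is the preimage in M of a copy of 𝒪_{I,p} inside the nonzero quotient
M/H. -/
theorem exists_extension (M : EqCoh k n) {H : Submodule (PolyRing k n) M.carrier}
    (hH : M.IsHomog H) (hne : H ≠ ⊤) :
    ∃ (H' : Submodule (PolyRing k n) M.carrier) (hH' : M.IsHomog H') (S : ShortComplex (EqCoh k n))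
      (I : Finset (Fin n)) (p : Fin n → ℤ), H < H' ∧ S.ShortExact ∧ S.X₁ = M.sub H hH ∧
        S.X₂ = M.sub H' hH' ∧ S.X₃ = strSheaf k I p := by
  obtain ⟨x, hx⟩ : ∃ x, x ∉ H := by
    by_contra! h
    exact hne (eq_top_iff.2 fun x _ => h x)
  obtain ⟨I, p, φ, hφ⟩ := exists_injective_strSheaf (M.quot H hH) (x := (M.quotπ H hH).toLin x)
    fun h => hx ((Submodule.Quotient.mk_eq_zero _).1 h)
  have hle : H ≤ (LinearMap.range φ.toLin).comap (M.quotπ H hH).toLin := fun y hy =>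
    ⟨0, (map_zero _).trans ((Submodule.Quotient.mk_eq_zero _).2 hy).symm⟩
  have hH' : M.IsHomog ((LinearMap.range φ.toLin).comap (M.quotπ H hH).toLin) := fun y hy q => by
    rw [Submodule.mem_comap, toLin_proj]
    exact range_isHomog φ _ hy q
  have hlift := lift_comp φ hφ (M.subι _ hH' ≫ M.quotπ H hH) fun z => z.2
  have hg : ∀ z, φ.toLin ((EqCoh.lift φ hφ (M.subι _ hH' ≫ M.quotπ H hH) fun z => z.2).toLin z) =
      (M.quotπ H hH).toLin z.1 := fun z => congrArg (fun t => t.toLin z) hlift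
  let S : ShortComplex (EqCoh k n) :=
    { X₁ := M.sub H hH
      X₂ := M.sub _ hH'
      X₃ := strSheaf k I p
      f := ⟨Submodule.inclusion hle, fun _ _ h => h⟩
      g := EqCoh.lift φ hφ (M.subι _ hH' ≫ M.quotπ H hH) fun z => z.2
      zero := by
        ext z
        refine hφ ((hg _).trans ?_)
        rw [zero_apply, map_zero]
        exact (Submodule.Quotient.mk_eq_zero _).2 z.2 }
  have hS : S.ShortExact :=
    { exact := exact_of_forall _ fun y hy => by
        have h : (M.quotπ H hH).toLin y.1 = 0 := by
          rw [← hg]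
          exact (congrArg _ hy).trans (map_zero _)
        exact ⟨⟨y.1, (Submodule.Quotient.mk_eq_zero _).1 h⟩, rfl⟩
      mono_f := mono_of_injective _ (Submodule.inclusion_injective hle)
      epi_g := epi_of_surjective _ fun y => by
        obtain ⟨m, hm⟩ := Submodule.mkQ_surjective H (φ.toLin y)
        exact ⟨⟨m, y, hm.symm⟩, hφ ((hg _).trans hm)⟩ }
  refine ⟨_, hH', S, I, p, lt_of_le_of_ne hle fun heq => ?_, hS, rfl, rfl, rfl⟩
  -- If H were not enlarged, the generator of 𝒪_{I,p} would map to zero in M/H.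
  refine strOne_ne_zero (k := k) I p (hφ ?_)
  obtain ⟨y, hy⟩ := (Submodule.mkQ_surjective H) (φ.toLin (strOne k I p))
  rw [map_zero, ← hy]
  refine (Submodule.Quotient.mk_eq_zero _).2 ?_
  rw [heq]
  exact ⟨_, hy.symm⟩

/-- The subobject given by all elements is the whole object. -/
def subTopIso (M : EqCoh k n) (h : M.IsHomog ⊤) : M.sub ⊤ h ≅ M where
  hom := M.subι ⊤ h
  inv := ⟨LinearMap.id.codRestrict ⊤ fun _ => trivial, fun _ _ h => h⟩

theorem isZero_sub_bot (M : EqCoh k n) (h : M.IsHomog ⊥) : IsZero (M.sub ⊥ h) := by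
  rw [IsZero.iff_id_eq_zero]
  ext x
  exact Subsingleton.elim (α := (⊥ : Submodule (PolyRing k n) M.carrier)) _ _

/-- A property of equivariant sheaves that is stable under extensions and kernels of epimorphisms
holds for all sheaves if it holds for `𝒪_{I,p}` with `p` supported in `I`. -/
theorem prop_of_strSheaf {R : ObjectProperty (EqCoh k n)} [R.IsClosedUnderIsomorphisms]
    [R.ContainsZero]
    (h₁ : ∀ S : ShortComplex (EqCoh k n), S.ShortExact → R S.X₂ → R S.X₃ → R S.X₁)
    (h₂ : ∀ S : ShortComplex (EqCoh k n), S.ShortExact → R S.X₁ → R S.X₃ → R S.X₂)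
    (h : ∀ (I : Finset (Fin n)) (p : Fin n → ℤ), (∀ i, p i ≠ 0 → i ∈ I) → R (strSheaf k I p))
    (M : EqCoh k n) : R M := by
  have hbot : M.IsHomog ⊥ := fun x hx q => by
    rw [Submodule.mem_bot] at hx ⊢
    rw [hx, map_zero]
  have : WellFoundedGT (Submodule (PolyRing k n) M.carrier) := inferInstance
  -- M is Noetherian, so a maximal homogeneous submodule with the property exists; a proper one
  -- could be enlarged.
  obtain ⟨H, ⟨hH, hR⟩, hmax⟩ := this.wf.has_min
    {H : Submodule (PolyRing k n) M.carrier | ∃ hH : M.IsHomog H, R (M.sub H hH)}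
    ⟨⊥, hbot, R.prop_of_isZero (isZero_sub_bot M hbot)⟩
  by_cases hne : H = ⊤
  · subst hne
    exact R.prop_of_iso (subTopIso M hH) hR
  · obtain ⟨H', hH', S, I, p, hlt, hS, e₁, e₂, e₃⟩ := exists_extension M hH hne
    refine absurd hlt (hmax H' ⟨hH', ?_⟩)
    rw [← e₂]
    refine h₂ S hS ?_ ?_
    · rwa [e₁]
    · rw [e₃]
      exact prop_strSheaf h₁ h₂ h I p

end EqCoh

/-! ### Fullness and the theorem -/

open EqCoh DerivedCategory

/-- The property is carried to its closure under isomorphism in the whole derived category, where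
truncations and triangles of short exact sequences are available. It descends again because the
inclusion is fully faithful. -/
theorem excObj_generate {P : ObjectProperty (DbCoh k n)} [P.IsTriangulated]
    [P.IsClosedUnderIsomorphisms] (h : ∀ a, P (excObj k a)) (X : DbCoh k n) : P X := by
  let R : ObjectProperty (DerivedCategory (EqCoh k n)) := P.map (ObjectProperty.ι _)
  have hR : ∀ Y : DbCoh k n, R Y.obj → P Y := by
    rintro Y ⟨Z, hZ, ⟨e⟩⟩
    exact P.prop_of_iso ((ObjectProperty.ι _).preimageIso (Y := Y) e) hZ
  refine hR X (prop_of_bounded R (fun F => ?_) X.property)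
  refine prop_of_strSheaf (R := R.inverseImage (singleFunctor (EqCoh k n) 0))
    (fun S hS => R.ext_of_isTriangulatedClosed₁ _ hS.singleTriangle_distinguished)
    (fun S hS => R.ext_of_isTriangulatedClosed₂ _ hS.singleTriangle_distinguished)
    (fun I p hp => ?_) F
  obtain ⟨a, -, ha⟩ := (bijOn_indexSet_indexTwist n).surjOn (show (I, p) ∈ _ from hp)
  obtain ⟨rfl, rfl⟩ := Prod.ext_iff.1 ha
  refine P.prop_map_obj (ObjectProperty.ι _) (X := DbCoh.ofSheaf (excSheaf k a)) ?_
  -- Stability under shifts makes the shift in E_a harmless.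
  rw [← P.prop_shift_iff_of_isStableUnderShift _ (∑ i, indexTwist a i)]
  exact h a

end

theorem theorem2 (k : Type u) [Field k] (n : ℕ) :
    -- the indices `a` parametrize all pairs `(I, p)` with `supp p ⊆ I`
    Set.BijOn (fun a : Fin n → ℤ => (indexSet a, indexTwist a)) Set.univ
      {x : Finset (Fin n) × (Fin n → ℤ) | ∀ i, x.2 i ≠ 0 → i ∈ x.1} ∧
    -- the objects `E_a`, ordered lexicographically, form a strong full exceptional collection
    IsStrongFullExceptionalCollection k
      (fun a : Lex (Fin n → ℤ) => (excObj k (ofLex a) : DbCoh k n)) ∧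
    -- the morphism spaces
    (∀ a b : Fin n → ℤ, HomCond a b → Module.finrank k (excObj k a ⟶ excObj k b) = 1) ∧
    (∀ a b : Fin n → ℤ, ¬ HomCond a b → ∀ f : excObj k a ⟶ excObj k b, f = 0) ∧
    -- the composition is nontrivial exactly when all three morphism spaces are
    (∀ a b c : Fin n → ℤ,
      (∃ (f : excObj k a ⟶ excObj k b) (g : excObj k b ⟶ excObj k c), f ≫ g ≠ 0) ↔
        Nontrivial (excObj k a ⟶ excObj k b) ∧ Nontrivial (excObj k b ⟶ excObj k c) ∧
          Nontrivial (excObj k a ⟶ excObj k c)) ∧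
    -- the distinguished generators
    ∃ ρ : ∀ a b : Fin n → ℤ, excObj k a ⟶ excObj k b,
      (∀ a b, Nontrivial (excObj k a ⟶ excObj k b) →
        ρ a b ≠ 0 ∧ Submodule.span k {ρ a b} = ⊤) ∧
      (∀ a b c, Nontrivial (excObj k a ⟶ excObj k b) → Nontrivial (excObj k b ⟶ excObj k c) →
        Nontrivial (excObj k a ⟶ excObj k c) → ρ a b ≫ ρ b c = ρ a c) := by
  refine ⟨bijOn_indexSet_indexTwist n, ?_, fun a b h => finrank_excObj_hom h,
    fun a b h => excObj_hom_eq_zero h, fun a b c => ?_, excGen k, fun a b h => ?_,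
    fun a b c h₁ h₂ h₃ => ?_⟩
  · exact
      { end_eq := fun a => finrank_excObj_hom (homCond_refl _)
        self_ext := fun a m hm f => excObj_hom_shift_eq_zero (Or.inl hm) f
        semiorthogonal := fun a b hab m f =>
          excObj_hom_shift_eq_zero (Or.inr fun h => not_le_of_gt hab h.toLex_le) f
        strong := fun a b m hm f => excObj_hom_shift_eq_zero (Or.inl hm) f
        full := fun P _ _ h X => excObj_generate (fun a => h (toLex a)) X }
  · refine ⟨fun ⟨f, g, hfg⟩ => ⟨⟨f, 0, ?_⟩, ⟨g, 0, ?_⟩, ⟨_, 0, hfg⟩⟩, fun ⟨h₁, h₂, h₃⟩ => ?_⟩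
    · rintro rfl
      exact hfg zero_comp
    · rintro rfl
      exact hfg comp_zero
    · rw [nontrivial_excObj_hom_iff] at h₁ h₂ h₃
      refine ⟨excGen k a b, excGen k b c, ?_⟩
      rw [excGen_comp h₁ h₂ h₃]
      exact excGen_ne_zero h₃
  · rw [nontrivial_excObj_hom_iff] at h
    refine ⟨excGen_ne_zero h, eq_top_iff.2 fun f _ => ?_⟩
    exact Submodule.mem_span_singleton.2 (exists_eq_smul_excGen h f)
  · rw [nontrivial_excObj_hom_iff] at h₁ h₂ h₃
    exact excGen_comp h₁ h₂ h₃
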